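/- Let $\mathbf{k}$ be an algebraically closed field, let $U$ be a finite-dimensional $\mathbf{k}$-vector space, and let $R=\bigoplus_{m\ge 0}R_m$ be a graded quotient ring of $\mathrm{Sym}(U)$. For $n\ge 0$ let $R[n]=\bigoplus_{m\ge 0}R_{mn}$ be the $n$-th Veronese ring, with $R_{mn}$ placed in degree $m$, regarded as a graded module over $\mathrm{Sym}(R_n)$, and let $\mathbf{k}$ be a $\mathrm{Sym}(R_n)$-module via $\mathrm{Sym}(R_n)\to\mathbf{k}$, $R_n\mapsto 0$. Let $\mathrm{D}^dU=\mathrm{Sym}^d(U^*)^*\subseteq U^{\otimes d}$ be the space of symmetric tensors (the $d$-th divided power), so that $\mathrm{Sym}(\mathrm{D}^dU)$ is the ring of polynomial functions on $\mathrm{Sym}^d(U^*)$, and let $Y_d\subseteq\mathrm{Sym}^d(U^*)$ be the affine cone over the Chow variety, i.e. the set of all forms $c\,\ell_1\cdots\ell_d$ with $c\in\mathbf{k}$ and $\ell_1,\dots,\ell_d\in U^*$. Fix integers $i,d\ge 0$ and put $$T=\bigoplus_{n\ge 0}\mathrm{Tor}_i^{\mathrm{Sym}(R_n)}(R[n],\mathbf{k})_d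 ,$$ where the subscript $d$ denotes the component of internal degree $d$. (1) There is a unique $\mathrm{Sym}(\mathrm{D}^dU)$-module structure on $T$, extending its $\mathbf{k}$-vector space structure, such that for every $u\in U$ the element $u^{\otimes d}\in\mathrm{D}^dU$ acts by the maps $$\mathrm{Tor}_i^{\mathrm{Sym}(R_n)}(R[n],\mathbf{k})_d\to\mathrm{Tor}_i^{\mathrm{Sym}(R_{n+1})}(R[n+1],\mathbf{k})_d$$ induced by multiplication by $u$, that is, by the ring homomorphism $\mathrm{Sym}(R_n)\to\mathrm{Sym}(R_{n+1})$ extending $u\colon R_n\to R_{n+1}$ together with the ring homomorphism $R[n]\to R[n+1]$ given by $u^m\colon R_{mn}\to R_{m(n+1)}$ in degree $m$. (2) With this structure, $T$ is a finitely generated $\mathrm{Sym}(\mathrm{D}^dU)$-module, and it is supported on $Y_d$: its support is contained in the closed subset of $\mathrm{Spec}\,\mathrm{Sym}(\mathrm{D}^dU)$ defined by the ideal of polynomial functions vanishing on $Y_d$. (3) Each $\mathrm{Tor}_i^{\mathrm{Sym}(R_n)}(R[n],\mathbf{k})_d$ is finite-dimensional, and there is a polynomial $P\in\mathbf{Q}[x]$,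 which is zero or of degree at most $(\dim U-1)d$, such that $\dim_{\mathbf{k}}\mathrm{Tor}_i^{\mathrm{Sym}(R_n)}(R[n],\mathbf{k})_d=P(n)$ for all sufficiently large $n$. -/

import Mathlib

open scoped TensorProduct DirectSum

universe u v

noncomputable section

/-! ## Graded Tor against the residue field

`S` is a commutative graded algebra over a field `k` with an augmentation `ε : S → k`, and `M` is
a graded `S`-module.  The iterated tensor products over `k`, `T 0 = M` and `T (p + 1) = S ⊗ T p`,
are `S`-modules through their first factor, and

`⋯ → S ⊗ T 2 → S ⊗ T 1 → S ⊗ T 0 → M → 0`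

is the (unnormalised) bar resolution of `M` by the graded free `S`-modules `S ⊗ T p`; it is
functorial in the pair `(S, M)`.  Applying `k ⊗_S -` gives the complex `⋯ → T 2 → T 1 → T 0`,
whose homology is `Tor^S(M, k)` with its internal grading. -/

/-- The action map `S ⊗ T → T` of an `S`-module `T`. -/
def actionMap (k : Type u) (S T : Type v) [Field k] [CommRing S] [Algebra k S]
    [AddCommGroup T] [Module k T] [Module S T] [IsScalarTower k S T] : S ⊗[k] T →ₗ[k] T :=
  TensorProduct.lift (Algebra.lsmul k k T).toLinearMap

/-- One stage of the bar resolution: an `S`-module `T`, its homogeneous pieces, and the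
differential `S ⊗ T → T` of the bar resolution. -/
structure BarStage (k : Type u) (S : Type v) [Field k] [CommRing S] [Algebra k S] where
  carrier : Type v
  [addCommGroup : AddCommGroup carrier]
  [moduleBase : Module k carrier]
  [moduleRing : Module S carrier]
  [isScalarTower : IsScalarTower k S carrier]
  deg : ℕ → Submodule k carrier
  res : S ⊗[k] carrier →ₗ[k] carrier

attribute [instance] BarStage.addCommGroup BarStage.moduleBase BarStage.moduleRing
  BarStage.isScalarTower

namespace BarStage

variable {k : Type u} {S : Type v} [Field k] [CommRing S] [Algebra k S]

/-- The grading of `S ⊗ T`: the piece of degree `d` is spanned by the `s ⊗ x` with `s` and `x`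
homogeneous of degrees adding up to `d`. -/
def tensorDeg (𝒮 : ℕ → Submodule k S) (B : BarStage k S) (d : ℕ) :
    Submodule k (S ⊗[k] B.carrier) :=
  ⨆ (a : ℕ) (b : ℕ) (_ : a + b = d),
    Submodule.map₂ (TensorProduct.mk k S B.carrier) (𝒮 a) (B.deg b)

/-- From `T` to `S ⊗ T`; the differential `S ⊗ (S ⊗ T) → S ⊗ T` is `s ⊗ y ↦ s • y - s ⊗ D y`
where `D : S ⊗ T → T` is the previous differential. -/
def next (𝒮 : ℕ → Submodule k S) (B : BarStage k S) : BarStage k S where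
  carrier := S ⊗[k] B.carrier
  deg := B.tensorDeg 𝒮
  res := actionMap k S (S ⊗[k] B.carrier) - LinearMap.lTensor S B.res

/-- The contraction `s ⊗ x ↦ ε s • x`, i.e. the projection `S ⊗ T → k ⊗_S (S ⊗ T) = T`. -/
def contraction (ε : S →ₐ[k] k) (B : BarStage k S) : S ⊗[k] B.carrier →ₗ[k] B.carrier :=
  (TensorProduct.lid k B.carrier).toLinearMap ∘ₗ LinearMap.rTensor B.carrier ε.toLinearMap

/-- The differential `S ⊗ T → T` obtained from `S ⊗ (S ⊗ T) → S ⊗ T` by applying `k ⊗_S -`: the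
latter sends `1 ⊗ x` to `x - 1 ⊗ D x`, whose class in `k ⊗_S (S ⊗ T) = T` is this one. -/
def diff (ε : S →ₐ[k] k) (B : BarStage k S) : S ⊗[k] B.carrier →ₗ[k] B.carrier :=
  B.contraction ε - B.res

end BarStage

open BarStage

section Tor

variable {k : Type u} {S M : Type v} [Field k] [CommRing S] [Algebra k S]
  [AddCommGroup M] [Module k M] [Module S M] [IsScalarTower k S M]

/-- The stage `T p = S ⊗ ⋯ ⊗ S ⊗ M` (with `p` factors `S`) of the bar resolution of `M`. The
differential `S ⊗ M → M` is the action of `S` on `M`. -/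
def bar (𝒮 : ℕ → Submodule k S) (ℳ : ℕ → Submodule k M) : ℕ → BarStage k S
  | 0 => { carrier := M, deg := ℳ, res := actionMap k S M }
  | p + 1 => (bar 𝒮 ℳ p).next 𝒮

/-- Cycles of internal degree `d` in `T p`. -/
def torCycles (ε : S →ₐ[k] k) (𝒮 : ℕ → Submodule k S) (ℳ : ℕ → Submodule k M) :
    ∀ p : ℕ, ℕ → Submodule k (bar 𝒮 ℳ p).carrier
  | 0, d => ℳ d
  | p + 1, d => ((bar 𝒮 ℳ p).tensorDeg 𝒮 d ⊓ LinearMap.ker ((bar 𝒮 ℳ p).diff ε) :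
      Submodule k (S ⊗[k] (bar 𝒮 ℳ p).carrier))

/-- Boundaries of internal degree `d` in `T p`. -/
def torBoundaries (ε : S →ₐ[k] k) (𝒮 : ℕ → Submodule k S) (ℳ : ℕ → Submodule k M) (p d : ℕ) :
    Submodule k (bar 𝒮 ℳ p).carrier :=
  ((bar 𝒮 ℳ p).tensorDeg 𝒮 d).map ((bar 𝒮 ℳ p).diff ε)

/-- `Tor_p^S(M, k)_d`, where `k` is an `S`-module through `ε`. -/
abbrev GradedTor (ε : S →ₐ[k] k) (𝒮 : ℕ → Submodule k S) (ℳ : ℕ → Submodule k M) (p d : ℕ) :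
    Type v :=
  torCycles ε 𝒮 ℳ p d ⧸ (torBoundaries ε 𝒮 ℳ p d).submoduleOf (torCycles ε 𝒮 ℳ p d)

end Tor

/-! The bar resolution is an exact complex of free `S`-modules: its differentials are `S`-linear
and compose to zero, and `x ↦ 1 ⊗ x` is a contracting homotopy. -/

section Exact

variable {k : Type u} {S M : Type v} [Field k] [CommRing S] [Algebra k S]
  [AddCommGroup M] [Module k M] [Module S M] [IsScalarTower k S M]

theorem actionMap_smul (T : Type v) [AddCommGroup T] [Module k T] [Module S T]
    [IsScalarTower k S T] (s : S) (x : S ⊗[k] T) :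
    actionMap k S T (s • x) = s • actionMap k S T x := by
  induction x using TensorProduct.induction_on with
  | zero => simp
  | add x y hx hy => rw [smul_add, map_add, map_add, hx, hy, smul_add]
  | tmul t m => simp [actionMap, TensorProduct.smul_tmul']

theorem lTensor_smul_aux {T T' : Type v} [AddCommGroup T] [Module k T] [AddCommGroup T']
    [Module k T'] (f : T →ₗ[k] T') (s : S) (x : S ⊗[k] T) :
    LinearMap.lTensor S f (s • x) = s • LinearMap.lTensor S f x := by
  induction x using TensorProduct.induction_on with
  | zero => simp
  | add x y hx hy => rw [smul_add, map_add, map_add, hx, hy, smul_add]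
  | tmul t m => simp [TensorProduct.smul_tmul']

theorem BarStage.res_next_tmul (𝒮 : ℕ → Submodule k S) (B : BarStage k S) (s : S)
    (y : S ⊗[k] B.carrier) :
    (B.next 𝒮).res (s ⊗ₜ[k] (y : (B.next 𝒮).carrier))
      = (s • y - s ⊗ₜ[k] B.res y : S ⊗[k] B.carrier) := by
  change (actionMap k S (S ⊗[k] B.carrier) - LinearMap.lTensor S B.res) (s ⊗ₜ[k] y) = _
  simp [actionMap]

theorem bar_res_smul (𝒮 : ℕ → Submodule k S) (ℳ : ℕ → Submodule k M) (p : ℕ) (s : S)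
    (x : S ⊗[k] (bar 𝒮 ℳ p).carrier) :
    (bar 𝒮 ℳ p).res (s • x) = s • (bar 𝒮 ℳ p).res x := by
  cases p with
  | zero =>
    have h : ∀ x : S ⊗[k] M, actionMap k S M (s • x) = s • actionMap k S M x :=
      actionMap_smul M s
    exact h x
  | succ p =>
    have h : ∀ (B : BarStage k S) (x : S ⊗[k] (S ⊗[k] B.carrier)),
        (actionMap k S (S ⊗[k] B.carrier) - LinearMap.lTensor S B.res) (s • x)
        = s • (actionMap k S (S ⊗[k] B.carrier) - LinearMap.lTensor S B.res) x := by
      intro B x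
      rw [LinearMap.sub_apply, LinearMap.sub_apply, smul_sub, actionMap_smul, lTensor_smul_aux]
    exact h (bar 𝒮 ℳ p) x

theorem bar_res_res (𝒮 : ℕ → Submodule k S) (ℳ : ℕ → Submodule k M) (p : ℕ)
    (x : S ⊗[k] (bar 𝒮 ℳ (p + 1)).carrier) :
    (bar 𝒮 ℳ p).res ((bar 𝒮 ℳ (p + 1)).res x : S ⊗[k] (bar 𝒮 ℳ p).carrier) = 0 := by
  have red : ∀ B : BarStage k S, (∀ (s : S) (x : S ⊗[k] B.carrier),
      B.res (s • x) = B.res (s ⊗ₜ[k] B.res x)) →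
      B.res ∘ₗ (actionMap k S (S ⊗[k] B.carrier) - LinearMap.lTensor S B.res) = 0 := by
    intro B hB
    refine TensorProduct.ext' fun s y => ?_
    simp [actionMap, hB]
  induction p with
  | zero =>
    refine LinearMap.congr_fun (red (bar 𝒮 ℳ 0) fun s y => ?_) x
    rw [bar_res_smul]
    rfl
  | succ p ih =>
    refine LinearMap.congr_fun (red (bar 𝒮 ℳ (p + 1)) fun s y => ?_) x
    rw [bar_res_smul]
    refine Eq.trans ?_ (BarStage.res_next_tmul 𝒮 (bar 𝒮 ℳ p) s _).symm
    rw [ih y, TensorProduct.tmul_zero, sub_zero]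
    rfl

end Exact

/-! ### Functoriality in the pair `(S, M)` -/

section Functoriality

variable {k : Type u} {S S' M M' : Type v} [Field k]
  [CommRing S] [Algebra k S] [CommRing S'] [Algebra k S']
  [AddCommGroup M] [Module k M] [Module S M] [IsScalarTower k S M]
  [AddCommGroup M'] [Module k M'] [Module S' M'] [IsScalarTower k S' M']

/-- The map `φ ⊗ ⋯ ⊗ φ ⊗ f` from `S ⊗ ⋯ ⊗ S ⊗ M` to `S' ⊗ ⋯ ⊗ S' ⊗ M'`. -/
def barMap (𝒮 : ℕ → Submodule k S) (ℳ : ℕ → Submodule k M)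
    (𝒮' : ℕ → Submodule k S') (ℳ' : ℕ → Submodule k M') (φ : S →ₐ[k] S') (f : M →ₗ[k] M') :
    ∀ p : ℕ, (bar 𝒮 ℳ p).carrier →ₗ[k] (bar 𝒮' ℳ' p).carrier
  | 0 => f
  | p + 1 => TensorProduct.map φ.toLinearMap (barMap 𝒮 ℳ 𝒮' ℳ' φ f p)

/-- A linear map between two stages that is `φ`-semilinear, commutes with the differentials of the
bar resolutions, and respects the gradings. -/
structure BarStage.Compat (φ : S →ₐ[k] S') (B : BarStage k S) (B' : BarStage k S')
    (f : B.carrier →ₗ[k] B'.carrier) : Prop where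
  smul : ∀ s x, f (s • x) = φ s • f x
  res : ∀ x, f (B.res x) = B'.res (TensorProduct.map φ.toLinearMap f x)
  deg : ∀ d, ∀ x ∈ B.deg d, f x ∈ B'.deg d

theorem BarStage.Compat.tensorDeg {φ : S →ₐ[k] S'} {B : BarStage k S} {B' : BarStage k S'}
    {f : B.carrier →ₗ[k] B'.carrier} (h : Compat φ B B' f)
    {𝒮 : ℕ → Submodule k S} {𝒮' : ℕ → Submodule k S'} (hφ : ∀ d, ∀ s ∈ 𝒮 d, φ s ∈ 𝒮' d)
    (d : ℕ) (x : S ⊗[k] B.carrier) (hx : x ∈ B.tensorDeg 𝒮 d) :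
    TensorProduct.map φ.toLinearMap f x ∈ B'.tensorDeg 𝒮' d := by
  suffices H : B.tensorDeg 𝒮 d ≤ (B'.tensorDeg 𝒮' d).comap (TensorProduct.map φ.toLinearMap f) from
    H hx
  refine iSup_le fun a => iSup_le fun b => iSup_le fun hab => Submodule.map₂_le.2 fun s hs y hy => ?_
  refine (le_iSup_of_le a <| le_iSup_of_le b <| le_iSup_of_le hab le_rfl :
    Submodule.map₂ (TensorProduct.mk k S' B'.carrier) (𝒮' a) (B'.deg b) ≤ B'.tensorDeg 𝒮' d) ?_
  exact Submodule.apply_mem_map₂ _ (hφ a s hs) (h.deg b y hy)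

theorem BarStage.Compat.diff {φ : S →ₐ[k] S'} {B : BarStage k S} {B' : BarStage k S'}
    {f : B.carrier →ₗ[k] B'.carrier} (h : Compat φ B B' f) {ε : S →ₐ[k] k} {ε' : S' →ₐ[k] k}
    (hε : ε'.comp φ = ε) (x : S ⊗[k] B.carrier) :
    f (B.diff ε x) = B'.diff ε' (TensorProduct.map φ.toLinearMap f x) := by
  rw [BarStage.diff, BarStage.diff, LinearMap.sub_apply, LinearMap.sub_apply, map_sub, h.res]
  congr 1
  subst hε
  induction x using TensorProduct.induction_on with
  | zero => simp
  | add x y hx hy => simp only [map_add, hx, hy]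
  | tmul s y => simp [contraction]

theorem BarStage.Compat.next {φ : S →ₐ[k] S'} {B : BarStage k S} {B' : BarStage k S'}
    {f : B.carrier →ₗ[k] B'.carrier} (h : Compat φ B B' f)
    {𝒮 : ℕ → Submodule k S} {𝒮' : ℕ → Submodule k S'} (hφ : ∀ d, ∀ s ∈ 𝒮 d, φ s ∈ 𝒮' d) :
    Compat φ (B.next 𝒮) (B'.next 𝒮') (TensorProduct.map φ.toLinearMap f) := by
  have hs : ∀ (s : S) (x : S ⊗[k] B.carrier), TensorProduct.map φ.toLinearMap f (s • x)
      = φ s • TensorProduct.map φ.toLinearMap f x := by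
    intro s x
    induction x using TensorProduct.induction_on with
    | zero => simp
    | add x y hx hy => rw [smul_add, map_add, map_add, smul_add, hx, hy]
    | tmul t y => simp [TensorProduct.smul_tmul']
  refine ⟨hs, fun x => ?_, h.tensorDeg hφ⟩
  have key : TensorProduct.map φ.toLinearMap f ∘ₗ
      (actionMap k S (S ⊗[k] B.carrier) - LinearMap.lTensor S B.res)
      = (actionMap k S' (S' ⊗[k] B'.carrier) - LinearMap.lTensor S' B'.res) ∘ₗ
        TensorProduct.map φ.toLinearMap (TensorProduct.map φ.toLinearMap f) := by
    refine TensorProduct.ext' fun s y => ?_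
    simp [actionMap, hs, h.res]
  exact LinearMap.congr_fun key x

theorem barMap_compat {𝒮 : ℕ → Submodule k S} {ℳ : ℕ → Submodule k M}
    {𝒮' : ℕ → Submodule k S'} {ℳ' : ℕ → Submodule k M'} {φ : S →ₐ[k] S'} {f : M →ₗ[k] M'}
    (hφ : ∀ d, ∀ s ∈ 𝒮 d, φ s ∈ 𝒮' d) (hf : ∀ d, ∀ m ∈ ℳ d, f m ∈ ℳ' d)
    (hsmul : ∀ s m, f (s • m) = φ s • f m) (p : ℕ) :
    Compat φ (bar 𝒮 ℳ p) (bar 𝒮' ℳ' p) (barMap 𝒮 ℳ 𝒮' ℳ' φ f p) := by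
  induction p with
  | zero =>
    refine ⟨hsmul, fun x => ?_, hf⟩
    have key : f ∘ₗ actionMap k S M = actionMap k S' M' ∘ₗ TensorProduct.map φ.toLinearMap f := by
      refine TensorProduct.ext' fun s m => ?_
      simp [actionMap, hsmul]
    exact LinearMap.congr_fun key x
  | succ p ih => exact ih.next hφ

/-- The map `Tor_p^S(M, k)_d → Tor_p^{S'}(M', k)_d` induced by a homomorphism `φ : S → S'` of
graded augmented algebras and a `φ`-semilinear graded map `f : M → M'`. -/
def gradedTorMap {ε : S →ₐ[k] k} {ε' : S' →ₐ[k] k} {𝒮 : ℕ → Submodule k S}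
    {ℳ : ℕ → Submodule k M} {𝒮' : ℕ → Submodule k S'} {ℳ' : ℕ → Submodule k M'}
    (φ : S →ₐ[k] S') (f : M →ₗ[k] M') (hε : ε'.comp φ = ε)
    (hφ : ∀ d, ∀ s ∈ 𝒮 d, φ s ∈ 𝒮' d) (hf : ∀ d, ∀ m ∈ ℳ d, f m ∈ ℳ' d)
    (hsmul : ∀ s m, f (s • m) = φ s • f m) (p d : ℕ) :
    GradedTor ε 𝒮 ℳ p d →ₗ[k] GradedTor ε' 𝒮' ℳ' p d :=
  Submodule.mapQ _ _
    ((barMap 𝒮 ℳ 𝒮' ℳ' φ f p).restrict (p := torCycles ε 𝒮 ℳ p d)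
      (q := torCycles ε' 𝒮' ℳ' p d) (by
        cases p with
        | zero => exact hf d
        | succ p =>
          intro x hx
          have hc := barMap_compat hφ hf hsmul p
          refine ⟨hc.tensorDeg hφ d x hx.1, ?_⟩
          change (bar 𝒮' ℳ' p).diff ε' (TensorProduct.map φ.toLinearMap _ x) = 0
          have h0 : (bar 𝒮 ℳ p).diff ε x = 0 := hx.2
          exact (hc.diff hε x).symm.trans ((congrArg _ h0).trans (map_zero _))))
    (by
      rintro x ⟨y, hy, hyx⟩
      have hc := barMap_compat hφ hf hsmul p
      exact ⟨_, hc.tensorDeg hφ d y hy, (hc.diff hε y).symm.trans (congrArg _ hyx)⟩)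

end Functoriality

/-! ## Veronese subrings -/

section Veronese

variable {k R : Type u} [Field k] [CommRing R] [Algebra k R]

/-- The grading of a symmetric algebra: degree `e` is spanned by the products of `e` vectors. -/
def symDeg (k : Type u) (V : Type v) [Field k] [AddCommGroup V] [Module k V] (e : ℕ) :
    Submodule k (SymmetricAlgebra k V) :=
  LinearMap.range (SymmetricAlgebra.ι k V) ^ e

/-- The functoriality map `Sym V → Sym W` of a linear map `V → W`. -/
def symMap {V W : Type u} [AddCommGroup V] [Module k V] [AddCommGroup W] [Module k W]
    (g : V →ₗ[k] W) : SymmetricAlgebra k V →ₐ[k] SymmetricAlgebra k W :=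
  SymmetricAlgebra.lift (SymmetricAlgebra.ι k W ∘ₗ g)

variable (𝒜 : ℕ → Submodule k R) [GradedAlgebra 𝒜]

/-- The degree `m` piece `R_{mn}` of the `n`-th Veronese ring `R[n]`. -/
def veronesePiece (n m : ℕ) : Submodule k R := 𝒜 (m * n)

instance (n : ℕ) : SetLike.GradedMonoid (veronesePiece 𝒜 n) where
  one_mem := by
    change (1 : R) ∈ 𝒜 (0 * n)
    rw [zero_mul]
    exact SetLike.GradedOne.one_mem
  mul_mem a b x y hx hy := by
    change x * y ∈ 𝒜 ((a + b) * n)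
    rw [add_mul]
    exact SetLike.GradedMul.mul_mem hx hy

/-- The `n`-th Veronese ring `R[n] = ⨁ m, R_{mn}`, with `R_{mn}` in degree `m`. -/
def Veronese (n : ℕ) : Type u := ⨁ m, veronesePiece 𝒜 n m

instance (n : ℕ) : CommRing (Veronese 𝒜 n) :=
  inferInstanceAs (CommRing (⨁ m, veronesePiece 𝒜 n m))

instance (n : ℕ) : Algebra k (Veronese 𝒜 n) :=
  inferInstanceAs (Algebra k (⨁ m, veronesePiece 𝒜 n m))

/-- The inclusion of `R_{mn}` as the degree `m` piece of `R[n]`. -/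
def veroneseIncl (n m : ℕ) : veronesePiece 𝒜 n m →ₗ[k] Veronese 𝒜 n :=
  DirectSum.lof k ℕ (fun m => veronesePiece 𝒜 n m) m

/-- The grading of `R[n]`. -/
def veroneseDeg (n m : ℕ) : Submodule k (Veronese 𝒜 n) := LinearMap.range (veroneseIncl 𝒜 n m)

/-- The inclusion `R_n → R[n]` in degree one. -/
def veroneseOne (n : ℕ) : 𝒜 n →ₗ[k] Veronese 𝒜 n :=
  veroneseIncl 𝒜 n 1 ∘ₗ Submodule.inclusion (by rw [veronesePiece, one_mul])

/-- The homomorphism `Sym(R_n) → R[n]` that is the identity on `R_n`. -/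
def symToVeronese (n : ℕ) : SymmetricAlgebra k (𝒜 n) →ₐ[k] Veronese 𝒜 n :=
  SymmetricAlgebra.lift (veroneseOne 𝒜 n)

instance (n : ℕ) : Module (SymmetricAlgebra k (𝒜 n)) (Veronese 𝒜 n) :=
  Module.compHom _ (symToVeronese 𝒜 n).toRingHom

instance (n : ℕ) : IsScalarTower k (SymmetricAlgebra k (𝒜 n)) (Veronese 𝒜 n) where
  smul_assoc c s m := by
    change symToVeronese 𝒜 n (c • s) * m = c • (symToVeronese 𝒜 n s * m)
    rw [map_smul, smul_mul_assoc]

/-- `Tor_i^{Sym(R_n)}(R[n], k)_d`. -/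
abbrev VeroneseTor (i d n : ℕ) : Type u :=
  GradedTor (k := k) (S := SymmetricAlgebra k (𝒜 n)) (M := Veronese 𝒜 n)
    SymmetricAlgebra.algebraMapInv (symDeg k (𝒜 n)) (veroneseDeg 𝒜 n) i d

/-! ### Multiplication by an element of degree one

For `x ∈ R_1`, multiplication by `x` is a map `R_n → R_{n+1}`; it induces a homomorphism
`Sym(R_n) → Sym(R_{n+1})`.  It is compatible with the ring homomorphism `R[n] → R[n+1]` that is
multiplication by `x ^ m` in degree `m`. -/

/-- Multiplication by `x ^ m` as a map `R_{mn} → R_{m(n+1)}`. -/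
def pieceMul (x : 𝒜 1) (n m : ℕ) : veronesePiece 𝒜 n m →ₗ[k] veronesePiece 𝒜 (n + 1) m :=
  (LinearMap.mulLeft k ((x : R) ^ m)).restrict (by
    intro y hy
    change (x : R) ^ m * y ∈ 𝒜 (m * (n + 1))
    have h1 : (x : R) ^ m ∈ 𝒜 (m • 1) := SetLike.pow_mem_graded m x.2
    have h2 := SetLike.GradedMul.mul_mem (A := 𝒜) h1 hy
    have e : m • 1 + m * n = m * (n + 1) := by rw [smul_eq_mul]; ring
    rwa [e] at h2)

/-- Multiplication by `x` as a map `R_n → R_{n+1}`. -/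
def degMul (x : 𝒜 1) (n : ℕ) : 𝒜 n →ₗ[k] 𝒜 (n + 1) :=
  (LinearMap.mulLeft k (x : R)).restrict (by
    intro y hy
    have h2 := SetLike.GradedMul.mul_mem (A := 𝒜) x.2 hy
    rwa [add_comm] at h2)

/-- The ring homomorphism `R[n] → R[n+1]` that is multiplication by `x ^ m` in degree `m`. -/
def veroneseMul (x : 𝒜 1) (n : ℕ) : Veronese 𝒜 n →ₐ[k] Veronese 𝒜 (n + 1) :=
  DirectSum.toAlgebra k (fun m => veronesePiece 𝒜 n m)
    (fun m => veroneseIncl 𝒜 (n + 1) m ∘ₗ pieceMul 𝒜 x n m)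
    (by
      refine congrArg (veroneseIncl 𝒜 (n + 1) 0) (Subtype.ext ?_)
      change (x : R) ^ 0 * 1 = 1
      simp)
    (by
      intro a b y z
      have h : (veroneseIncl 𝒜 (n + 1) a (pieceMul 𝒜 x n a y) : Veronese 𝒜 (n + 1)) *
          veroneseIncl 𝒜 (n + 1) b (pieceMul 𝒜 x n b z)
          = veroneseIncl 𝒜 (n + 1) (a + b)
            ⟨(pieceMul 𝒜 x n a y : R) * pieceMul 𝒜 x n b z,
              SetLike.GradedMul.mul_mem (pieceMul 𝒜 x n a y).2 (pieceMul 𝒜 x n b z).2⟩ :=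
        DirectSum.of_mul_of (A := fun m => ↥(veronesePiece 𝒜 (n + 1) m))
          (pieceMul 𝒜 x n a y) (pieceMul 𝒜 x n b z)
      refine Eq.trans ?_ h.symm
      refine congrArg (veroneseIncl 𝒜 (n + 1) (a + b)) (Subtype.ext ?_)
      change (x : R) ^ (a + b) * ((y : R) * z) = (x : R) ^ a * y * ((x : R) ^ b * z)
      ring)

theorem veroneseMul_incl (x : 𝒜 1) (n m : ℕ) (y : veronesePiece 𝒜 n m) :
    veroneseMul 𝒜 x n (veroneseIncl 𝒜 n m y)
      = veroneseIncl 𝒜 (n + 1) m (pieceMul 𝒜 x n m y) :=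
  DirectSum.toModule_lof (R := k) (M := fun m => veronesePiece 𝒜 n m) (N := Veronese 𝒜 (n + 1))
    (φ := fun m => veroneseIncl 𝒜 (n + 1) m ∘ₗ pieceMul 𝒜 x n m) m y

theorem symMap_mem_symDeg {V W : Type u} [AddCommGroup V] [Module k V] [AddCommGroup W]
    [Module k W] (g : V →ₗ[k] W) (e : ℕ) (s : SymmetricAlgebra k V) (hs : s ∈ symDeg k V e) :
    symMap g s ∈ symDeg k W e := by
  have h : (LinearMap.range (SymmetricAlgebra.ι k V)).map (symMap g).toLinearMap
      ≤ LinearMap.range (SymmetricAlgebra.ι k W) := by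
    rintro _ ⟨_, ⟨v, rfl⟩, rfl⟩
    exact ⟨g v, by simp [symMap]⟩
  have h2 : symMap g s ∈ (LinearMap.range (SymmetricAlgebra.ι k V) ^ e).map
      (symMap g).toLinearMap := ⟨s, hs, rfl⟩
  rw [Submodule.map_pow] at h2
  exact pow_le_pow_left' h e h2

theorem veroneseMul_symToVeronese (x : 𝒜 1) (n : ℕ) :
    (veroneseMul 𝒜 x n).comp (symToVeronese 𝒜 n)
      = (symToVeronese 𝒜 (n + 1)).comp (symMap (degMul 𝒜 x n)) := by
  refine SymmetricAlgebra.algHom_ext (LinearMap.ext fun y => ?_)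
  change veroneseMul 𝒜 x n (symToVeronese 𝒜 n (SymmetricAlgebra.ι k (𝒜 n) y))
    = symToVeronese 𝒜 (n + 1) (symMap (degMul 𝒜 x n) (SymmetricAlgebra.ι k (𝒜 n) y))
  rw [symToVeronese, symToVeronese, symMap, SymmetricAlgebra.lift_ι_apply,
    SymmetricAlgebra.lift_ι_apply, LinearMap.comp_apply, SymmetricAlgebra.lift_ι_apply,
    veroneseOne, LinearMap.comp_apply, veroneseMul_incl]
  refine congrArg (veroneseIncl 𝒜 (n + 1) 1) (Subtype.ext ?_)
  change (x : R) ^ 1 * (y : R) = (x : R) * y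
  rw [pow_one]

/-- The map `Tor_i^{Sym(R_n)}(R[n], k)_d → Tor_i^{Sym(R_{n+1})}(R[n+1], k)_d` induced by
multiplication by `x ∈ R_1`. -/
def veroneseTorMap (x : 𝒜 1) (i d n : ℕ) : VeroneseTor 𝒜 i d n →ₗ[k] VeroneseTor 𝒜 i d (n + 1) :=
  gradedTorMap (symMap (degMul 𝒜 x n)) (veroneseMul 𝒜 x n).toLinearMap
    (SymmetricAlgebra.algHom_ext (LinearMap.ext fun y => by
      simp [symMap, SymmetricAlgebra.algebraMapInv]))
    (symMap_mem_symDeg (degMul 𝒜 x n))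
    (by
      rintro m _ ⟨y, rfl⟩
      exact ⟨_, (veroneseMul_incl 𝒜 x n m y).symm⟩)
    (by
      intro s m
      change veroneseMul 𝒜 x n (symToVeronese 𝒜 n s * m)
        = symToVeronese 𝒜 (n + 1) (symMap (degMul 𝒜 x n) s) * veroneseMul 𝒜 x n m
      rw [map_mul]
      congr 1
      exact AlgHom.congr_fun (veroneseMul_symToVeronese 𝒜 x n) s)
    i d

/-- `⨁ n ≥ 0, Tor_i^{Sym(R_n)}(R[n], k)_d`. -/
abbrev VeroneseTorSum (i d : ℕ) : Type u := ⨁ n, VeroneseTor 𝒜 i d n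

end Veronese

/-! ## Divided powers and the Chow variety -/

section Chow

variable (k : Type u) (U : Type v) [Field k] [AddCommGroup U] [Module k U]

/-- The divided power `D^d U = Sym^d(U^*)^*`: the symmetric tensors in `U ⊗ ⋯ ⊗ U` (`d` factors). -/
def dividedPower (d : ℕ) : Submodule k (⨂[k] _ : Fin d, U) :=
  ⨅ σ : Equiv.Perm (Fin d),
    LinearMap.eqLocus (PiTensorProduct.reindex k (fun _ : Fin d => U) σ).toLinearMap LinearMap.id

variable {U}

/-- The divided power `u^{[d]} = u ⊗ ⋯ ⊗ u ∈ D^d U` of a vector. -/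
def dpow (d : ℕ) (u : U) : dividedPower k U d :=
  ⟨PiTensorProduct.tprod k fun _ => u, by
    simp [dividedPower, Submodule.mem_iInf, LinearMap.mem_eqLocus]⟩

variable {k}

/-- The degree `d` form `ℓ₁ ⋯ ℓ_d` on `U`, as a point of `Sym^d(U^*) = (D^d U)^*`: the functional
`t ↦ (ℓ₁ ⊗ ⋯ ⊗ ℓ_d)(t)` on symmetric tensors. -/
def prodForm {d : ℕ} (ℓ : Fin d → Module.Dual k U) : Module.Dual k (dividedPower k U d) :=
  PiTensorProduct.lift ((MultilinearMap.mkPiAlgebra k (Fin d) k).compLinearMap ℓ) ∘ₗ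
    (dividedPower k U d).subtype

variable (k U)

/-- The affine cone over the Chow variety in `Sym^d(U^*) = (D^d U)^*`: the forms that decompose
into a product of linear factors, up to a scalar (which can be absorbed into a factor if `d ≥ 1`). -/
def chowVariety (d : ℕ) : Set (Module.Dual k (dividedPower k U d)) :=
  {F | ∃ (c : k) (ℓ : Fin d → Module.Dual k U), F = c • prodForm ℓ}

/-- The ideal of all polynomial functions `f ∈ Sym(D^d U) = k[Sym^d(U^*)]` that vanish on the Chow
variety; the value of `f` at the point `F : D^d U → k` is the extension of `F` to `Sym(D^d U)`. -/
def chowIdeal (d : ℕ) : Ideal (SymmetricAlgebra k (dividedPower k U d)) :=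
  ⨅ F ∈ chowVariety k U d, RingHom.ker (SymmetricAlgebra.lift F)

end Chow

section Action

variable {k R : Type u} {U : Type v} [Field k] [AddCommGroup U] [Module k U]
  [CommRing R] [Algebra k R] (𝒜 : ℕ → Submodule k R) [GradedAlgebra 𝒜]

/-- The action of `Sym(D^d U)` on `⨁ n, Tor_i^{Sym(R_n)}(R[n], k)_d` given by multiplication:
`u^{[d]}` acts by the maps `Tor_i^{Sym(R_n)}(R[n], k)_d → Tor_i^{Sym(R_{n+1})}(R[n+1], k)_d`
induced by multiplication by the image `g u ∈ R_1` of `u`. -/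
def IsMultiplicationAction (g : U →ₗ[k] 𝒜 1) (i d : ℕ)
    (ρ : SymmetricAlgebra k (dividedPower k U d) →ₐ[k] Module.End k (VeroneseTorSum 𝒜 i d)) :
    Prop :=
  ∀ (u : U) (n : ℕ) (x : VeroneseTor 𝒜 i d n),
    ρ (SymmetricAlgebra.ι k _ (dpow k d u)) (DirectSum.lof k ℕ (VeroneseTor 𝒜 i d) n x)
      = DirectSum.lof k ℕ (VeroneseTor 𝒜 i d) (n + 1) (veroneseTorMap 𝒜 (g u) i d n x)

end Action

end

/-! In homological degree p, the part of internal degree d of the bar complex of R[n] is a sum of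
spaces Sym^{a_1}(R_n) ⊗ ⋯ ⊗ Sym^{a_p}(R_n) ⊗ R_{bn} with a_1 + ⋯ + a_p + b = d; the number of
summands does not depend on n. Since R is generated in degree one, R_{bn} is spanned by products of
b elements of R_n. So each summand is a quotient of R_n^{⊗d}, hence of Sym^n(U)^{⊗d}, and
multiplication by u becomes multiplication by u ⊗ ⋯ ⊗ u (`multilinearlyGenerated_bar`,
`exists_isMultiplicationSystem`). Thus T is a subquotient of finitely many copies of A = ⨁
Sym^n(U)^{⊗d}, and it suffices to understand A. The subquotient is encoded by linear relations
between the copies of A_n and the Tor groups (`IsMultiplicationSystem`).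

A_n is realised as the space `multiDeg` of polynomials of degree n in the coefficients of each of d
generic linear forms. One further variable records n and plays the role of the scalar c. Sym(D^d U)
acts by pullback along (c, ℓ_1, …, ℓ_d) ↦ c ℓ_1 ⋯ ℓ_d, a map with image Y_d, so the ideal of Y_d
acts by zero.

Finiteness comes from the fact that a product of linear forms vanishes only if a factor does. By the
Nullstellensatz the ideal generated by D^d U contains, up to radical, every product of one
coefficient from each form, hence everything of multidegree (n, …, n) for large n
(`exists_multiDeg_succ_le`). So A is contained in a Noetherian module, and T is Noetherian.

The action is unique because the u^{[d]} span D^d U (`span_range_dpow`). It exists because every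
linear relation between them holds on A and therefore on T. Finally, the Hilbert function of T is
eventually a polynomial by induction on the number of operators
(`eventuallyPolynomial_finrank_sub`), and dim A_n ≤ (n + 1)^{(dim U - 1)d} bounds its degree when U
≠ 0. -/

noncomputable section

/-! ### Hilbert functions of graded modules -/

section HilbertFunction

/-- Every rational polynomial is the difference `q (x + 1) - q x` of a polynomial `q`. -/
theorem Polynomial.exists_eval_add_one_sub_eval (p : Polynomial ℚ) :
    ∃ q : Polynomial ℚ, ∀ x : ℚ, q.eval (x + 1) - q.eval x = p.eval x := by
  induction p using Polynomial.induction_on' with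
  | add p q hp hq =>
    obtain ⟨P, hP⟩ := hp
    obtain ⟨Q, hQ⟩ := hq
    exact ⟨P + Q, fun x => by
      rw [Polynomial.eval_add, Polynomial.eval_add, Polynomial.eval_add, ← hP, ← hQ]; ring⟩
  | monomial n a =>
    -- Bernoulli polynomials satisfy B_{n+1}(x + 1) - B_{n+1}(x) = (n + 1) x^n.
    refine ⟨Polynomial.C (a / (n + 1)) * Polynomial.bernoulli (n + 1), fun x => ?_⟩
    have hn : (n : ℚ) + 1 ≠ 0 := by positivity
    have h := Polynomial.bernoulli_eval_one_add (n + 1) x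
    rw [Nat.add_sub_cancel] at h
    simp only [add_comm x 1, Polynomial.eval_mul, h, Polynomial.eval_C, Polynomial.eval_monomial]
    push_cast
    field_simp
    ring

/-- The function `h` agrees with a rational polynomial at all large arguments. -/
def EventuallyPolynomial (h : ℕ → ℚ) : Prop :=
  ∃ P : Polynomial ℚ, ∀ᶠ n : ℕ in Filter.atTop, h n = P.eval (n : ℚ)

theorem EventuallyPolynomial.sub {h h' : ℕ → ℚ} (H : EventuallyPolynomial h)
    (H' : EventuallyPolynomial h') : EventuallyPolynomial (fun n => h n - h' n) := by
  obtain ⟨P, hP⟩ := H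
  obtain ⟨Q, hQ⟩ := H'
  exact ⟨P - Q, by filter_upwards [hP, hQ] with n h1 h2; simp [h1, h2]⟩

theorem EventuallyPolynomial.comp_add_one {h : ℕ → ℚ} (H : EventuallyPolynomial h) :
    EventuallyPolynomial (fun n => h (n + 1)) := by
  obtain ⟨P, hP⟩ := H
  refine ⟨P.comp (Polynomial.X + 1), ?_⟩
  filter_upwards [(Filter.tendsto_add_atTop_nat 1).eventually hP] with n hn
  simp [hn]

theorem EventuallyPolynomial.of_diff {h : ℕ → ℚ}
    (H : EventuallyPolynomial (fun n => h (n + 1) - h n)) : EventuallyPolynomial h := by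
  obtain ⟨P, hP⟩ := H
  obtain ⟨Q, hQ⟩ := P.exists_eval_add_one_sub_eval
  obtain ⟨N, hN⟩ := Filter.eventually_atTop.1 hP
  -- A summation of `P` is determined up to a constant, which is fixed by the value at `N`.
  refine ⟨Q + Polynomial.C (h N - Q.eval (N : ℚ)), Filter.eventually_atTop.2 ⟨N, fun n hn => ?_⟩⟩
  induction n, hn using Nat.le_induction with
  | base => simp
  | succ n hn ih =>
    have h1 := hN n hn
    have h2 := hQ n
    simp only [Polynomial.eval_add, Polynomial.eval_C] at ih ⊢
    push_cast
    linarith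

variable {k : Type u} [Field k] {V : ℕ → Type v} [∀ n, AddCommGroup (V n)] [∀ n, Module k (V n)]
  {s : ℕ} (y : Fin s → ∀ n, V n →ₗ[k] V (n + 1))

/-- A graded subspace that is stable under the operators `y i` of degree one. -/
def IsStableFamily (N : ∀ n, Submodule k (V n)) : Prop :=
  ∀ i n, N n ≤ (N (n + 1)).comap (y i n)

/-- Every stable graded subspace is generated in bounded degrees. -/
def StableFamiliesFG : Prop :=
  ∀ N : ∀ n, Submodule k (V n), IsStableFamily y N →
    ∀ᶠ n in Filter.atTop, N (n + 1) ≤ ⨆ i, (N n).map (y i n)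

/-- Both sides are the dimension of the image of `N` in `W' ⧸ N'`. -/
theorem finrank_sub_eq_of_map {W W' : Type v} [AddCommGroup W] [Module k W] [AddCommGroup W']
    [Module k W'] [FiniteDimensional k W] [FiniteDimensional k W'] (f : W →ₗ[k] W')
    (N : Submodule k W) (N' : Submodule k W') :
    (Module.finrank k N : ℚ) - Module.finrank k (N ⊓ N'.comap f : Submodule k W)
      = Module.finrank k (N' ⊔ N.map f : Submodule k W') - Module.finrank k N' := by
  have h1 := Submodule.finrank_sup_add_finrank_inf_eq N' (N.map f)
  have h2 := LinearMap.finrank_range_add_finrank_ker (f.domRestrict N)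
  have h3 := LinearMap.finrank_range_add_finrank_ker
    (f.domRestrict (N ⊓ N'.comap f : Submodule k W))
  have e1 : LinearMap.range (f.domRestrict N) = N.map f := by
    rw [LinearMap.domRestrict, LinearMap.range_comp, Submodule.range_subtype]
  have e2 : LinearMap.range (f.domRestrict (N ⊓ N'.comap f : Submodule k W)) = N' ⊓ N.map f := by
    rw [LinearMap.domRestrict, LinearMap.range_comp, Submodule.range_subtype]
    ext x
    constructor
    · rintro ⟨z, ⟨hz, hz'⟩, rfl⟩
      exact ⟨hz', z, hz, rfl⟩
    · rintro ⟨hx, z, hz, rfl⟩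
      exact ⟨z, ⟨hz, hx⟩, rfl⟩
  have e3 : Module.finrank k (LinearMap.ker (f.domRestrict N))
      = Module.finrank k (LinearMap.ker (f.domRestrict (N ⊓ N'.comap f : Submodule k W))) := by
    have e : N ⊓ N'.comap f ⊓ LinearMap.ker f = N ⊓ LinearMap.ker f := by
      refine le_antisymm (fun x hx => ⟨hx.1.1, hx.2⟩) (fun x hx => ⟨⟨hx.1, ?_⟩, hx.2⟩)
      have : f x = 0 := hx.2
      simp [this]
    rw [LinearMap.ker_domRestrict, LinearMap.ker_domRestrict,
      ← Submodule.finrank_map_subtype_eq, ← Submodule.finrank_map_subtype_eq,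
      Submodule.map_comap_subtype, Submodule.map_comap_subtype, e]
  rw [e1] at h2
  rw [e2] at h3
  rw [e3] at h2
  have h1' : (Module.finrank k (N' ⊔ N.map f : Submodule k W') : ℚ)
    + Module.finrank k (N' ⊓ N.map f : Submodule k W') = Module.finrank k N'
    + Module.finrank k (N.map f) := by exact_mod_cast h1
  have h2' : (Module.finrank k (N.map f) : ℚ) + Module.finrank k
    (LinearMap.ker (f.domRestrict (N ⊓ N'.comap f : Submodule k W))) = Module.finrank k N := by
    exact_mod_cast h2
  have h3' : (Module.finrank k (N' ⊓ N.map f : Submodule k W') : ℚ) + Module.finrank k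
    (LinearMap.ker (f.domRestrict (N ⊓ N'.comap f : Submodule k W)))
    = Module.finrank k (N ⊓ N'.comap f : Submodule k W) := by exact_mod_cast h3
  linarith

/-- Induction on a bound `t` such that all operators of index at least `t` annihilate the module
N/N'. The next operator `z` annihilates its own kernel K/N' and cokernel N/C on N/N', so the
induction hypothesis applies to both, and the exact sequence of `z` expresses the first difference
of the Hilbert function of N/N' through theirs. Working with pairs of subspaces of a fixed `V`
avoids forming quotients. -/
theorem eventuallyPolynomial_finrank_sub [∀ n, FiniteDimensional k (V n)]
    (hcomm : ∀ i j n x, y i (n + 1) (y j n x) = y j (n + 1) (y i n x))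
    (hfg : StableFamiliesFG y) (t : ℕ) :
    ∀ N N' : ∀ n, Submodule k (V n), IsStableFamily y N → IsStableFamily y N' →
      (∀ n, N' n ≤ N n) → (∀ i : Fin s, t ≤ i → ∀ n, N n ≤ (N' (n + 1)).comap (y i n)) →
      EventuallyPolynomial (fun n => Module.finrank k (N n) - Module.finrank k (N' n)) := by
  induction t with
  | zero =>
    intro N N' hN hN' hle h0
    refine ⟨0, ?_⟩
    -- In high degrees `N` is generated by the previous piece, which every operator sends into `N'`:
    -- the quotient vanishes eventually.
    have h1 : ∀ᶠ n in Filter.atTop, N (n + 1) = N' (n + 1) := by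
      filter_upwards [hfg N hN] with n hn
      refine le_antisymm (hn.trans (iSup_le fun i => ?_)) (hle _)
      exact Submodule.map_le_iff_le_comap.2 (h0 i (Nat.zero_le _) n)
    obtain ⟨n₀, hn₀⟩ := Filter.eventually_atTop.1 h1
    refine Filter.eventually_atTop.2 ⟨n₀ + 1, fun n hn => ?_⟩
    obtain ⟨m, rfl⟩ : ∃ m, n = m + 1 := ⟨n - 1, by omega⟩
    have e := congrArg (fun W : Submodule k (V (m + 1)) => (Module.finrank k W : ℚ))
      (hn₀ m (by omega))
    simpa [sub_eq_zero] using e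
  | succ t ih =>
    intro N N' hN hN' hle h0
    by_cases ht : t < s
    swap
    · exact ih N N' hN hN' hle fun i hi n => absurd i.2 (by omega)
    let z := y ⟨t, ht⟩
    let K : ∀ n, Submodule k (V n) := fun n => N n ⊓ (N' (n + 1)).comap (z n)
    -- Nothing maps to degree 0, so there the cokernel of `z` is all of N/N'.
    let C : ∀ n, Submodule k (V n) := fun n => match n with
      | 0 => N' 0
      | n + 1 => N' (n + 1) ⊔ (N n).map (z n)
    have hCN : ∀ n, C n ≤ N n := by
      intro n
      cases n with
      | zero => exact hle 0
      | succ n => exact sup_le (hle _) (Submodule.map_le_iff_le_comap.2 (hN _ n))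
    have hC' : ∀ n, N' n ≤ C n := by
      intro n
      cases n with
      | zero => exact le_rfl
      | succ n => exact le_sup_left
    have hK : IsStableFamily y K := fun i n x hx =>
      ⟨hN i n hx.1, by
        change y _ (n + 1) (y i n x) ∈ N' (n + 2)
        rw [hcomm]
        exact hN' i (n + 1) hx.2⟩
    have hC : IsStableFamily y C := by
      intro i n
      cases n with
      | zero => exact (hN' i 0).trans (Submodule.comap_mono (hC' 1))
      | succ n =>
        refine sup_le ((hN' i (n + 1)).trans (Submodule.comap_mono (hC' _))) ?_
        rintro _ ⟨x, hx, rfl⟩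
        refine Submodule.mem_sup_right (?_ : y i (n + 1) (z n x) ∈ _)
        rw [hcomm]
        exact ⟨_, hN i n hx, rfl⟩
    have split : ∀ i : Fin s, t ≤ i → i = ⟨t, ht⟩ ∨ t + 1 ≤ i := by
      intro i hi
      rcases hi.eq_or_lt with h | h
      · exact Or.inl (Fin.ext h.symm)
      · exact Or.inr h
    have PK := ih K N' hK hN' (fun n => le_inf (hle n) (hN' _ n)) fun i hi n => by
      rcases split i hi with rfl | h
      · exact inf_le_right
      · exact inf_le_left.trans (h0 i h n)
    have PC := ih N C hN hC hCN fun i hi n => by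
      rcases split i hi with rfl | h
      · exact Submodule.map_le_iff_le_comap.1 (show _ ≤ C (n + 1) from le_sup_right)
      · exact (h0 i h n).trans (Submodule.comap_mono (hC' _))
    refine EventuallyPolynomial.of_diff ?_
    convert PC.comp_add_one.sub PK using 2 with n
    have := finrank_sub_eq_of_map (z n) (N n) (N' (n + 1))
    change _ = (_ - (Module.finrank k (N' (n + 1) ⊔ (N n).map (z n) : Submodule k (V (n + 1))) : ℚ))
      - ((Module.finrank k (N n ⊓ (N' (n + 1)).comap (z n) : Submodule k (V n)) : ℚ) - _)
    linarith

/-- The Hilbert function of a graded Noetherian module is eventually a polynomial. -/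
theorem eventuallyPolynomial_finrank [∀ n, FiniteDimensional k (V n)]
    (hcomm : ∀ i j n x, y i (n + 1) (y j n x) = y j (n + 1) (y i n x))
    (hfg : StableFamiliesFG y) : EventuallyPolynomial (fun n => Module.finrank k (V n)) := by
  have := eventuallyPolynomial_finrank_sub y hcomm hfg s (fun _ => ⊤) (fun _ => ⊥)
    (fun _ _ _ _ => trivial) (fun i n x hx => by
      have : x = 0 := hx
      simp [this]) (fun _ => bot_le) (fun i hi => absurd i.2 (by omega))
  simpa using this

open Polynomial in
-- A polynomial of degree greater than `e` eventually exceeds twice the bound in absolute value, as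
-- the bound has degree at most `e`.
theorem Polynomial.natDegree_le_of_eventually_le {P : Polynomial ℚ} {e c : ℕ} {h : ℕ → ℕ}
    (hP : ∀ᶠ n : ℕ in Filter.atTop, (h n : ℚ) = P.eval (n : ℚ))
    (hle : ∀ n, h n ≤ c * (n + 1) ^ e) : P.natDegree ≤ e := by
  by_contra! hlt
  let Q : ℝ[X] := C (c : ℝ) * (X + 1) ^ e
  let P' : ℝ[X] := P.map (algebraMap ℚ ℝ)
  have hdeg : Q.degree < P'.degree := by
    rw [degree_map]
    have h1 : Q.natDegree ≤ e := by
      refine natDegree_C_mul_le _ _ |>.trans (natDegree_pow_le.trans ?_)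
      have : (X + 1 : ℝ[X]).natDegree = 1 := by simpa using natDegree_X_add_C (1 : ℝ)
      simp [this]
    exact (degree_le_of_natDegree_le h1).trans_lt (by
      rw [degree_eq_natDegree (by rintro rfl; simp at hlt)]
      exact_mod_cast hlt)
  have ho := (isLittleO_atTop_of_degree_lt Q P' hdeg).comp_tendsto tendsto_natCast_atTop_atTop
  have hne : ∀ᶠ n : ℕ in Filter.atTop, P'.eval (n : ℝ) ≠ 0 :=
    tendsto_natCast_atTop_atTop.eventually
      (eventually_atTop_not_isRoot P' (by rintro h0; simp [h0] at hdeg))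
  have hb := ho.def (show (0 : ℝ) < 1 / 2 by norm_num)
  obtain ⟨n, h1, h2, h3⟩ := (hb.and (hne.and hP)).exists
  have h4 : P'.eval (n : ℝ) = h n := by
    have := congrArg (algebraMap ℚ ℝ) h3
    rw [← Polynomial.eval_map_apply] at this
    simpa [P'] using this.symm
  have h5 : (h n : ℝ) ≤ Q.eval (n : ℝ) := by
    have := hle n
    simp only [Q, eval_mul, eval_C, eval_pow, eval_add, eval_X, eval_one]
    exact_mod_cast this
  simp only [Function.comp_apply, h4, Real.norm_eq_abs] at h1
  rw [h4] at h2
  have h6 : (0 : ℝ) < h n := lt_of_le_of_ne (Nat.cast_nonneg _) h2.symm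
  rw [abs_of_pos h6, abs_of_pos (h6.trans_le h5)] at h1
  linarith

end HilbertFunction

/-! ### Symmetric tensors are spanned by powers of vectors -/

section SymmetricTensors

/-- Equal multiplicities mean that corresponding fibres of `I` and `I'` are equinumerous; bijections
between the fibres glue to a permutation. -/
theorem exists_perm_of_sum_single_eq {d : ℕ} {κ : Type*} {I I' : Fin d → κ}
    (h : ∑ j, Finsupp.single (I j) 1 = ∑ j, Finsupp.single (I' j) (1 : ℕ)) :
    ∃ σ : Equiv.Perm (Fin d), I' = I ∘ σ := by
  classical
  have hc : ∀ c, Nonempty ({j // I' j = c} ≃ {j // I j = c}) := by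
    intro c
    have := DFunLike.congr_fun h c
    simp only [Finsupp.finsetSum_apply, Finsupp.single_apply, Finset.sum_boole] at this
    refine Fintype.card_eq.1 ?_
    rw [Fintype.card_subtype, Fintype.card_subtype]
    exact_mod_cast this.symm
  let e := fun c => (hc c).some
  refine ⟨(Equiv.sigmaFiberEquiv I').symm.trans
    ((Equiv.sigmaCongrRight e).trans (Equiv.sigmaFiberEquiv I)), funext fun j => ?_⟩
  exact (e (I' j) ⟨j, rfl⟩).2.symm

variable {k : Type u} {U : Type v} [Field k] [AddCommGroup U] [Module k U]
  {κ : Type} (b : Module.Basis κ k U)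

theorem piTensorProduct_repr_perm {d : ℕ} (t : dividedPower k U d) (σ : Equiv.Perm (Fin d))
    (I : Fin d → κ) :
    (Basis.piTensorProduct fun _ => b).repr (t : ⨂[k] _ : Fin d, U) (I ∘ σ)
      = (Basis.piTensorProduct fun _ => b).repr (t : ⨂[k] _ : Fin d, U) I := by
  have ht : PiTensorProduct.reindex k (fun _ : Fin d => U) σ (t : ⨂[k] _ : Fin d, U) = t := by
    exact (Submodule.mem_iInf _).1 t.2 σ
  conv_rhs => rw [← ht]
  induction (t : ⨂[k] _ : Fin d, U) using PiTensorProduct.induction_on with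
  | smul_tprod r f =>
    simp only [map_smul, Finsupp.smul_apply, PiTensorProduct.reindex_tprod,
      Basis.piTensorProduct_repr_tprod_apply]
    congr 1
    exact Fintype.prod_equiv σ _ _ fun j => by simp
  | add x y hx hy => simp only [map_add, Finsupp.add_apply, hx, hy]

/-- Over an infinite field the divided powers `u^{[d]}` span `D^d U`. -/
theorem span_range_dpow [Infinite k] [Fintype κ] (b : Module.Basis κ k U) (d : ℕ) :
    Submodule.span k (Set.range (dpow k (U := U) d)) = ⊤ := by
  classical
  by_contra hne
  obtain ⟨f₀, hf₀, hspan⟩ := Submodule.exists_le_ker_of_lt_top _ (lt_top_iff_ne_top.2 hne)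
  obtain ⟨f, hf⟩ := LinearMap.exists_extend f₀
  refine hf₀ (LinearMap.ext fun t => ?_)
  let bt := Basis.piTensorProduct (R := k) (fun _ : Fin d => b)
  let wt : (Fin d → κ) → (κ →₀ ℕ) := fun I => ∑ j, Finsupp.single (I j) 1
  -- The value of `G` at `x` is `f` at the d-th tensor power of `∑ x i • b i`. It vanishes for all
  -- `x`, and over an infinite field this forces `G = 0`: the sum of `f (bt I)` over all `I` of a
  -- given content is zero.
  let G : MvPolynomial κ k := ∑ I, MvPolynomial.monomial (wt I) (f (bt I))
  have hG : G = 0 := by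
    refine MvPolynomial.funext fun x => ?_
    have hu : dpow k d (∑ i, x i • b i) ∈ Submodule.span k (Set.range (dpow k (U := U) d)) :=
      Submodule.subset_span ⟨_, rfl⟩
    have h0 : f (PiTensorProduct.tprod k fun _ : Fin d => ∑ i, x i • b i) = 0 := by
      have h1 : f₀ (dpow k d (∑ i, x i • b i)) = 0 := hspan hu
      rw [← hf] at h1
      exact h1
    rw [MultilinearMap.map_sum, map_sum] at h0
    rw [map_zero, map_sum, ← h0]
    refine Finset.sum_congr rfl fun I _ => ?_
    rw [MultilinearMap.map_smul_univ, map_smul, MvPolynomial.eval_monomial,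
      Basis.piTensorProduct_apply, smul_eq_mul, mul_comm]
    congr 1
    simp only [wt]
    rw [← Finsupp.prod_finsetSum_index (by simp) (by intros; rw [pow_add])]
    simp
  let c : (Fin d → κ) → k := fun I => bt.repr (t : ⨂[k] _ : Fin d, U) I
  -- The coordinates of a symmetric tensor depend only on the content of the index. So `f t` is a
  -- linear combination of coefficients of `G`, namely the image of `G` under `Λ`.
  let cc : (κ →₀ ℕ) → k := fun α => if h : ∃ I, wt I = α then c h.choose else 0
  have hcc : ∀ I, cc (wt I) = c I := by
    intro I
    have h : ∃ I', wt I' = wt I := ⟨I, rfl⟩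
    simp only [cc, dif_pos h]
    obtain ⟨σ, hσ⟩ := exists_perm_of_sum_single_eq h.choose_spec
    conv_rhs => rw [hσ]
    exact (piTensorProduct_repr_perm b t σ _).symm
  let Λ : MvPolynomial κ k →ₗ[k] k := (MvPolynomial.basisMonomials κ k).constr k cc
  have hΛ : Λ G = f t := by
    rw [← bt.sum_repr (t : ⨂[k] _ : Fin d, U), map_sum, map_sum]
    refine Finset.sum_congr rfl fun I _ => ?_
    have : MvPolynomial.monomial (wt I) (f (bt I))
        = f (bt I) • MvPolynomial.basisMonomials κ k (wt I) := by
      simp [MvPolynomial.smul_monomial]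
    rw [this, map_smul, map_smul, Module.Basis.constr_basis, hcc, smul_eq_mul, smul_eq_mul,
      mul_comm]
  rw [hG, map_zero] at hΛ
  rw [← hf]
  exact hΛ.symm

end SymmetricTensors

/-! ### The product map on linear forms and its finiteness -/

section ProductMap

open MvPolynomial

variable {k : Type u} {U : Type v} [Field k] [AddCommGroup U] [Module k U]
  {κ : Type} (b : Module.Basis κ k U) (d : ℕ)

/-- The `j`-th of `d` generic linear forms on `U`, with indeterminate coefficients. -/
def genericForm (j : Fin d) : U →ₗ[k] MvPolynomial (Fin d × κ) k :=
  b.constr k fun i => X (j, i)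

/-- A vector of `D^d U`, as a function of the coefficients of `d` linear forms: its value at
the product of these forms. -/
def prodPullLinear : dividedPower k U d →ₗ[k] MvPolynomial (Fin d × κ) k :=
  PiTensorProduct.lift ((MultilinearMap.mkPiAlgebra k (Fin d) _).compLinearMap (genericForm b d)) ∘ₗ
    (dividedPower k U d).subtype

/-- The pullback of polynomial functions on `Sym^d(U^*)` along `(c, ℓ₁, …, ℓ_d) ↦ c ℓ₁ ⋯ ℓ_d`. -/
def prodPull :
    SymmetricAlgebra k (dividedPower k U d) →ₐ[k] Polynomial (MvPolynomial (Fin d × κ) k) :=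
  SymmetricAlgebra.lift ((Polynomial.monomial 1).restrictScalars k ∘ₗ prodPullLinear b d)

theorem prodPullLinear_dpow (u : U) :
    prodPullLinear b d (dpow k d u) = ∏ j, genericForm b d j u := by
  change PiTensorProduct.lift _ (PiTensorProduct.tprod k fun _ => u) = _
  simp

theorem prodPull_ι (t : dividedPower k U d) :
    prodPull b d (SymmetricAlgebra.ι k _ t) = Polynomial.monomial 1 (prodPullLinear b d t) :=
  SymmetricAlgebra.lift_ι_apply _ _

/-- Specialising the scalar to `c` and the coefficients to `z` turns the pullback of `f` into the
value of `f` at a point of the Chow variety. All these values are zero, and a polynomial over an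
infinite field is determined by its values. -/
theorem prodPull_eq_zero_of_mem_chowIdeal [Infinite k]
    {f : SymmetricAlgebra k (dividedPower k U d)} (hf : f ∈ chowIdeal k U d) :
    prodPull b d f = 0 := by
  have key : ∀ z : Fin d × κ → k, (prodPull b d f).map (eval z) = 0 := by
    refine fun z => Polynomial.funext fun c => ?_
    let ℓ : Fin d → Module.Dual k U := fun j => (aeval z).toLinearMap ∘ₗ genericForm b d j
    let E : Polynomial (MvPolynomial (Fin d × κ) k) →ₐ[k] k :=
      (Polynomial.aeval c).comp (Polynomial.mapAlgHom (aeval z))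
    have hE : ∀ p, E p = (p.map (eval z)).eval c := fun p => rfl
    have h : E.comp (prodPull b d) = SymmetricAlgebra.lift (c • prodForm ℓ) := by
      refine SymmetricAlgebra.algHom_ext (LinearMap.ext fun t => ?_)
      change E (prodPull b d (SymmetricAlgebra.ι k _ t))
        = SymmetricAlgebra.lift (c • prodForm ℓ) (SymmetricAlgebra.ι k _ t)
      rw [prodPull_ι, SymmetricAlgebra.lift_ι_apply, hE, Polynomial.map_monomial,
        Polynomial.eval_monomial, pow_one, mul_comm]
      have : (aeval z).toLinearMap ∘ₗ PiTensorProduct.lift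
          ((MultilinearMap.mkPiAlgebra k (Fin d) _).compLinearMap (genericForm b d))
          = PiTensorProduct.lift ((MultilinearMap.mkPiAlgebra k (Fin d) k).compLinearMap ℓ) := by
        refine PiTensorProduct.ext (MultilinearMap.ext fun x => ?_)
        simp [ℓ]
      exact congrArg (c * ·) (LinearMap.congr_fun this (t : ⨂[k] _ : Fin d, U))
    have h1 : SymmetricAlgebra.lift (c • prodForm ℓ) f = 0 := by
      have := hf
      simp only [chowIdeal, Submodule.mem_iInf] at this
      exact this (c • prodForm ℓ) ⟨c, ℓ, rfl⟩
    rw [← h] at h1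
    rw [Polynomial.eval_zero, ← hE]
    exact h1
  ext1 n
  refine MvPolynomial.funext fun z => ?_
  have := congrArg (Polynomial.coeff · n) (key z)
  simpa using this

/-- The multidegree of the coefficients of `d` linear forms. -/
def formWeight (κ : Type) (d : ℕ) : Fin d × κ → Fin d → ℕ := fun p => Pi.single p.1 1

/-- The polynomials that are homogeneous of degree `n` in the coefficients of each of `d` linear
forms. -/
def multiDeg (k : Type u) [Field k] (κ : Type) (d n : ℕ) :
    Submodule k (MvPolynomial (Fin d × κ) k) :=
  weightedHomogeneousSubmodule k (formWeight κ d) fun _ => n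

theorem weight_formWeight [Fintype κ] (α : Fin d × κ →₀ ℕ) (j : Fin d) :
    Finsupp.weight (formWeight κ d) α j = ∑ i, α (j, i) := by
  classical
  rw [Finsupp.weight_apply, Finsupp.sum_fintype _ _ (by simp), Fintype.sum_prod_type,
    Finset.sum_apply]
  simp only [Finset.sum_apply, formWeight, Pi.smul_apply, Pi.single_apply, smul_eq_mul]
  rw [Finset.sum_eq_single j]
  · simp
  · intro i _ hi
    simp [hi.symm]
  · simp

theorem genericForm_apply [Fintype κ] (j : Fin d) (u : U) :
    genericForm b d j u = ∑ i, b.repr u i • X (j, i) := by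
  rw [genericForm, Module.Basis.constr_apply_fintype]
  simp

theorem genericForm_isWeightedHomogeneous [Fintype κ] (j : Fin d) (u : U) :
    IsWeightedHomogeneous (formWeight κ d) (genericForm b d j u) (Pi.single j 1) := by
  rw [genericForm_apply, ← mem_weightedHomogeneousSubmodule]
  exact Submodule.sum_mem _ fun i _ => Submodule.smul_mem _ _ (isWeightedHomogeneous_X k _ (j, i))

theorem prodPullLinear_mem [Fintype κ] (t : dividedPower k U d) :
    prodPullLinear b d t ∈ multiDeg k κ d 1 := by
  change PiTensorProduct.lift _ (t : ⨂[k] _ : Fin d, U) ∈ _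
  induction (t : ⨂[k] _ : Fin d, U) using PiTensorProduct.induction_on with
  | smul_tprod r x =>
    rw [map_smul]
    refine Submodule.smul_mem _ _ ?_
    simp only [PiTensorProduct.lift.tprod, MultilinearMap.compLinearMap_apply,
      MultilinearMap.mkPiAlgebra_apply]
    have := IsWeightedHomogeneous.prod Finset.univ (fun j => genericForm b d j (x j))
      (fun j => Pi.single j 1) fun j _ => genericForm_isWeightedHomogeneous b d j (x j)
    rwa [Finset.univ_sum_single] at this
  | add x y hx hy =>
    rw [map_add]
    exact Submodule.add_mem _ hx hy

theorem weightedHomogeneousComponent_mul_of_right {σ M : Type*} [AddCancelCommMonoid M]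
    (w : σ → M) (p q : MvPolynomial σ k) (m m' : M) (hq : IsWeightedHomogeneous w q m') :
    weightedHomogeneousComponent w (m + m') (p * q) = weightedHomogeneousComponent w m p * q := by
  classical
  let _ := weightedGradedAlgebra k w
  have := DirectSum.coe_decompose_mul_add_of_right_mem (weightedHomogeneousSubmodule k w)
    (a := p) (b := q) (i := m) (j := m') hq
  exact (decompose'_apply k w _ _).symm.trans
    (this.trans (congrArg (· * q) (decompose'_apply k w p m)))

/-- The hypothesis says that the product of the `d` specialised forms vanishes at every vector, so
it is zero as a polynomial; polynomials form a domain, so one factor is zero. -/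
theorem exists_genericForm_eq_zero [Infinite k] [Fintype κ] (z : Fin d × κ → k)
    (hz : ∀ u, eval z (prodPullLinear b d (dpow k d u)) = 0) : ∃ j, ∀ i, z (j, i) = 0 := by
  let ℓ : Fin d → MvPolynomial κ k := fun j => ∑ i, C (z (j, i)) * X i
  have h : ∏ j, ℓ j = 0 := by
    refine MvPolynomial.funext fun x => ?_
    have := hz (∑ i, x i • b i)
    rw [prodPullLinear_dpow, map_prod] at this
    rw [map_prod, map_zero, ← this]
    refine Finset.prod_congr rfl fun j _ => ?_
    simp only [ℓ, map_sum, map_smul, genericForm, Module.Basis.constr_basis]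
    simp [mul_comm]
  obtain ⟨j, -, hj⟩ := Finset.prod_eq_zero_iff.1 h
  classical
  refine ⟨j, fun i => ?_⟩
  have := congrArg (eval (Pi.single i 1)) hj
  simpa [ℓ, Pi.single_apply] using this

/-- By the Nullstellensatz it is enough to check the common zeros, and at such a point all
coefficients of one of the forms vanish. -/
theorem prod_X_mem_radical [IsAlgClosed k] [Fintype κ] (φ : Fin d → κ) :
    ∏ j, (X (j, φ j) : MvPolynomial (Fin d × κ) k)
      ∈ (Ideal.span (Set.range (prodPullLinear b d))).radical := by
  have : Infinite k := IsAlgClosed.instInfinite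
  rw [← vanishingIdeal_zeroLocus_eq_radical (K := k), mem_vanishingIdeal_iff]
  intro z hz
  rw [zeroLocus_span] at hz
  obtain ⟨j, hj⟩ := exists_genericForm_eq_zero b d z fun u => by
    simpa [aeval_eq_eval] using hz _ ⟨dpow k d u, rfl⟩
  rw [map_prod]
  exact Finset.prod_eq_zero (Finset.mem_univ j) (by simp [hj])

/-- The generators are homogeneous of multidegree (1, …, 1), so membership in the ideal they
generate can be refined to have homogeneous coefficients. The extra factor `q` makes the induction
pass through scalar multiplication. -/
theorem weightedHomogeneousComponent_mem_of_mem_span [Fintype κ]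
    {p : MvPolynomial (Fin d × κ) k} (hp : p ∈ Ideal.span (Set.range (prodPullLinear b d)))
    (n : ℕ) (q : MvPolynomial (Fin d × κ) k) :
    weightedHomogeneousComponent (formWeight κ d) (fun _ => n + 1) (q * p)
      ∈ LinearMap.range (prodPullLinear b d) * multiDeg k κ d n := by
  induction hp using Submodule.span_induction generalizing q with
  | mem p hp =>
    obtain ⟨t, rfl⟩ := hp
    have := weightedHomogeneousComponent_mul_of_right (formWeight κ d) q (prodPullLinear b d t)
      (fun _ => n) (fun _ => 1) (prodPullLinear_mem b d t)
    refine this.symm ▸ ?_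
    rw [mul_comm (weightedHomogeneousComponent _ _ _)]
    exact Submodule.mul_mem_mul ⟨t, rfl⟩ 
      (weightedHomogeneousComponent_mem (formWeight κ d) q fun _ => n)
  | zero => simp
  | add x y _ _ hx hy =>
    rw [mul_add, map_add]
    exact Submodule.add_mem _ (hx q) (hy q)
  | smul a x _ hx =>
    rw [smul_eq_mul, ← mul_assoc]
    exact hx _

/-- In high degrees, `⨁ Sym^n(U) ⊗ ⋯ ⊗ Sym^n(U)` is generated by `D^d U`. -/
theorem exists_multiDeg_succ_le [IsAlgClosed k] [Fintype κ] :
    ∃ n₀, ∀ n ≥ n₀, multiDeg k κ d (n + 1)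
      ≤ LinearMap.range (prodPullLinear b d) * multiDeg k κ d n := by
  let I : Ideal (MvPolynomial (Fin d × κ) k) := Ideal.span (Set.range (prodPullLinear b d))
  obtain ⟨N, hN⟩ := Ideal.exists_radical_pow_le_of_fg I (IsNoetherian.noetherian _)
  -- Pigeonhole: once the degree in each form exceeds `card κ * N`, each form has a coefficient of
  -- exponent at least `N`, so every monomial is divisible by the N-th power of a product of one
  -- coefficient per form.
  refine ⟨Fintype.card κ * N, fun n hn p hp => ?_⟩
  have hpI : p ∈ I := by
    rw [p.as_sum]
    refine Ideal.sum_mem _ fun α hα => ?_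
    have hα' : ∀ j, ∑ i, α (j, i) = n + 1 := fun j => by
      rw [← weight_formWeight, hp (mem_support_iff.1 hα)]
    have hex : ∀ j, ∃ i, N ≤ α (j, i) := by
      intro j
      by_contra! hlt
      have h1 : ∑ i, α (j, i) ≤ ∑ _i : κ, N := Finset.sum_le_sum fun i _ => (hlt i).le
      rw [hα', Finset.sum_const, Finset.card_univ, smul_eq_mul] at h1
      omega
    choose φ hφ using hex
    have h1 : (∏ j, (X (j, φ j) : MvPolynomial (Fin d × κ) k)) ^ N ∈ I :=
      hN (Ideal.pow_mem_pow (prod_X_mem_radical b d φ) N)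
    have h2 : (∏ j, (X (j, φ j) : MvPolynomial (Fin d × κ) k)) ^ N
        = monomial (∑ j, Finsupp.single (j, φ j) N) 1 := by
      rw [← Finset.prod_pow, monomial_sum_one]
      exact Finset.prod_congr rfl fun j _ => by rw [X_pow_eq_monomial]
    have h3 : ∑ j, Finsupp.single (j, φ j) N ≤ α := by
      classical
      rintro ⟨j, i⟩
      rw [Finsupp.finsetSum_apply, Finset.sum_eq_single j]
      · rw [Finsupp.single_apply]
        split_ifs with h
        · have h' : φ j = i := congrArg Prod.snd h
          rw [← h']
          exact hφ j
        · exact Nat.zero_le _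
      · intro j' _ hj
        rw [Finsupp.single_apply, if_neg fun h => hj (congrArg Prod.fst h)]
      · simp
    have h4 : monomial α (coeff α p) = monomial (α - ∑ j, Finsupp.single (j, φ j) N) (coeff α p)
        * monomial (∑ j, Finsupp.single (j, φ j) N) 1 := by
      rw [monomial_mul, mul_one, tsub_add_cancel_of_le h3]
    rw [h4, ← h2]
    exact Ideal.mul_mem_left _ _ h1
  have := weightedHomogeneousComponent_mem_of_mem_span b d hpI n 1
  rwa [one_mul, weightedHomogeneousComponent_eq_self hp] at this

/-- The exponents of the monomials of degree `n` in the coefficients of each of `d` linear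
forms. -/
abbrev MultiExponent (κ : Type) (d n : ℕ) : Type :=
  {α : Fin d × κ →₀ ℕ // Finsupp.weight (formWeight κ d) α = fun _ => n}

theorem MultiExponent.le [Fintype κ] {d n : ℕ} (α : MultiExponent κ d n) (j : Fin d) (i : κ) :
    α.1 (j, i) < n + 1 := by
  have := congrFun α.2 j
  rw [weight_formWeight] at this
  exact Nat.lt_succ_of_le ((Finset.single_le_sum (f := fun i => α.1 (j, i))
    (fun _ _ => Nat.zero_le _) (Finset.mem_univ i)).trans this.le)

instance [Fintype κ] (n : ℕ) : Finite (MultiExponent κ d n) :=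
  Finite.of_injective (fun α => fun p : Fin d × κ => (⟨α.1 p, α.le p.1 p.2⟩ : Fin (n + 1)))
    fun _ _ h => Subtype.ext (Finsupp.ext fun p => congrArg Fin.val (congrFun h p))

/-- For each form the exponent of one chosen coefficient is determined by the others, and all
exponents are at most `n`. -/
theorem MultiExponent.card_le [Fintype κ] (n : ℕ) :
    Nat.card (MultiExponent κ d n) ≤ (n + 1) ^ ((Fintype.card κ - 1) * d) := by
  classical
  rcases isEmpty_or_nonempty κ with h | ⟨⟨i₀⟩⟩
  · have : Subsingleton (MultiExponent κ d n) :=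
      ⟨fun α β => Subtype.ext (Finsupp.ext fun p => isEmptyElim p.2)⟩
    exact (Finite.card_le_one_iff_subsingleton.2 this).trans (Nat.one_le_pow _ _ n.succ_pos)
  · have hinj : Function.Injective fun (α : MultiExponent κ d n) (p : Fin d × {i // i ≠ i₀}) =>
        (⟨α.1 (p.1, p.2), α.le _ _⟩ : Fin (n + 1)) := by
      intro α β h
      have hne : ∀ j i, i ≠ i₀ → α.1 (j, i) = β.1 (j, i) := fun j i hi =>
        congrArg Fin.val (congrFun h (j, ⟨i, hi⟩))
      refine Subtype.ext (Finsupp.ext fun p => ?_)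
      obtain ⟨j, i⟩ := p
      by_cases hi : i = i₀
      · subst hi
        have h1 := congrFun α.2 j
        have h2 := congrFun β.2 j
        rw [weight_formWeight, ← Finset.add_sum_erase _ _ (Finset.mem_univ i)] at h1 h2
        have h3 : ∑ x ∈ Finset.univ.erase i, α.1 (j, x) = ∑ x ∈ Finset.univ.erase i, β.1 (j, x) :=
          Finset.sum_congr rfl fun x hx => hne j x (Finset.ne_of_mem_erase hx)
        omega
      · exact hne j i hi
    refine (Nat.card_le_card_of_injective _ hinj).trans_eq ?_
    rw [Nat.card_eq_fintype_card, Fintype.card_fun, Fintype.card_fin, Fintype.card_prod,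
      Fintype.card_fin, Fintype.card_subtype_compl, Fintype.card_subtype_eq, mul_comm]

/-- The basis of monomials of the polynomials of degree `n` in the coefficients of each of `d`
linear forms. -/
def multiDegBasis (n : ℕ) : Module.Basis (MultiExponent κ d n) k (multiDeg k κ d n) :=
  Module.Basis.ofRepr ((LinearEquiv.ofEq _ _ (weightedHomogeneousSubmodule_eq_finsupp_supported k
    (formWeight κ d) fun _ => n)).trans (AddMonoidAlgebra.supportedEquivFinsupp _))

theorem finiteDimensional_multiDeg [Fintype κ] (n : ℕ) :
    FiniteDimensional k (multiDeg k κ d n) :=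
  Module.Finite.of_basis (multiDegBasis d n)

theorem finrank_multiDeg_le [Fintype κ] (n : ℕ) :
    Module.finrank k (multiDeg k κ d n) ≤ (n + 1) ^ ((Fintype.card κ - 1) * d) := by
  rw [Module.finrank_eq_nat_card_basis (multiDegBasis d n)]
  exact MultiExponent.card_le d n

/-- Without variables there are no monomials of positive degree. This covers U = 0, where the
natural subtraction in `finrank_multiDeg_le` loses the sign of dim U - 1. -/
theorem finrank_multiDeg_eq_zero [IsEmpty κ] {n : ℕ} (hd : d ≠ 0) (hn : n ≠ 0) :
    Module.finrank k (multiDeg k κ d n) = 0 := by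
  rw [Module.finrank_eq_nat_card_basis (multiDegBasis d n)]
  refine @Nat.card_of_isEmpty _ ⟨fun α => hn ?_⟩
  have := congrFun α.2 ⟨0, Nat.pos_of_ne_zero hd⟩
  rw [Subsingleton.elim α.1 0] at this
  simpa using this.symm

/-- The action of `Sym(D^d U)` on the polynomial functions of a scalar and `d` linear forms. -/
@[reducible]
def prodPullModule : Module (SymmetricAlgebra k (dividedPower k U d))
    (Polynomial (MvPolynomial (Fin d × κ) k)) :=
  Module.compHom _ (prodPull b d).toRingHom

theorem exists_fg_multiDeg_le [IsAlgClosed k] [Fintype κ] :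
    letI := prodPullModule b d
    ∃ S : Submodule (SymmetricAlgebra k (dividedPower k U d))
      (Polynomial (MvPolynomial (Fin d × κ) k)),
      S.FG ∧ ∀ n, ∀ p ∈ multiDeg k κ d n, Polynomial.monomial n p ∈ S := by
  let _ := prodPullModule b d
  obtain ⟨n₀, h₀⟩ := exists_multiDeg_succ_le b d
  have := fun n => finiteDimensional_multiDeg (k := k) (κ := κ) d n
  have hfg : ∀ n, ∃ s : Finset (MvPolynomial (Fin d × κ) k),
      Submodule.span k (s : Set _) = multiDeg k κ d n :=
    fun n => (Submodule.fg_iff_finiteDimensional _).2 inferInstance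
  choose s hs using hfg
  have : IsScalarTower k (SymmetricAlgebra k (dividedPower k U d))
      (Polynomial (MvPolynomial (Fin d × κ) k)) :=
    ⟨fun c f p => by
      change prodPull b d (c • f) * p = c • (prodPull b d f * p)
      rw [map_smul, smul_mul_assoc]⟩
  classical
  let S := Submodule.span (SymmetricAlgebra k (dividedPower k U d))
    (((Finset.range (n₀ + 1)).biUnion fun n => (s n).image (Polynomial.monomial n) : Finset _) :
      Set (Polynomial (MvPolynomial (Fin d × κ) k)))
  have hS : ∀ n < n₀ + 1, multiDeg k κ d n
      ≤ (S.restrictScalars k).comap ((Polynomial.monomial n).restrictScalars k) := by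
    intro n hn
    rw [← hs, Submodule.span_le]
    exact fun p hp => Submodule.subset_span (Finset.mem_coe.2 (Finset.mem_biUnion.2
      ⟨n, Finset.mem_range.2 hn, Finset.mem_image_of_mem _ hp⟩))
  refine ⟨S, ⟨_, rfl⟩, fun n => ?_⟩
  suffices h : multiDeg k κ d n
      ≤ (S.restrictScalars k).comap ((Polynomial.monomial n).restrictScalars k) from
    fun p hp => h hp
  induction n with
  | zero => exact hS 0 n₀.succ_pos
  | succ n ih =>
    by_cases hn : n₀ ≤ n
    · refine (h₀ n hn).trans (Submodule.mul_le.2 ?_)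
      rintro _ ⟨t, rfl⟩ p hp
      have h1 := S.smul_mem (SymmetricAlgebra.ι k _ t) (ih hp)
      change prodPull b d (SymmetricAlgebra.ι k _ t) * Polynomial.monomial n p ∈ S at h1
      rw [prodPull_ι, Polynomial.monomial_mul_monomial, add_comm 1 n] at h1
      exact h1
    · exact hS (n + 1) (by omega)

end ProductMap

/-- The first projection embeds `Z` in a finite power of the Noetherian module `S`. -/
theorem isNoetherian_of_fst_mem {R M T J : Type*} [CommRing R] [IsNoetherianRing R]
    [AddCommGroup M] [Module R M] [AddCommGroup T] [Module R T] [Finite J] {S : Submodule R M}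
    (hS : S.FG) {Z : Submodule R ((J → M) × T)} (hfst : ∀ x ∈ Z, ∀ j, x.1 j ∈ S)
    (hinj : ∀ x ∈ Z, x.1 = 0 → x.2 = 0) : IsNoetherian R Z := by
  have := isNoetherian_of_fg_of_noetherian S hS
  let F : Z →ₗ[R] J → S := LinearMap.pi fun j => LinearMap.codRestrict S
    (LinearMap.proj j ∘ₗ LinearMap.fst _ _ _ ∘ₗ Z.subtype) fun x => hfst x.1 x.2 j
  refine isNoetherian_of_injective F fun x y hxy => ?_
  have h1 : x.1.1 - y.1.1 = 0 :=
    funext fun j => sub_eq_zero.2 (congrArg Subtype.val (congrFun hxy j))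
  have h2 := hinj _ (Z.sub_mem x.2 y.2) h1
  exact Subtype.ext (Prod.ext (sub_eq_zero.1 h1) (sub_eq_zero.1 h2))

/-! ### Modules over symmetric algebras -/

section SymmetricAlgebraModules

variable {k : Type u} [Field k] {D : Type v} [AddCommGroup D] [Module k D]

theorem SymmetricAlgebra.isNoetherianRing [FiniteDimensional k D] :
    IsNoetherianRing (SymmetricAlgebra k D) :=
  isNoetherianRing_of_ringEquiv _
    (SymmetricAlgebra.equivMvPolynomial (Module.finBasis k D)).symm.toRingEquiv

variable {T : Type w} [AddCommGroup T] [Module k T]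

theorem SymmetricAlgebra.smul_mem_of_ι_smul_mem [Module (SymmetricAlgebra k D) T]
    [IsScalarTower k (SymmetricAlgebra k D) T] {W : Submodule k T}
    (hW : ∀ t, ∀ x ∈ W, SymmetricAlgebra.ι k D t • x ∈ W) (f : SymmetricAlgebra k D) :
    ∀ x ∈ W, f • x ∈ W := by
  induction f using SymmetricAlgebra.induction with
  | algebraMap c =>
    intro x hx
    rw [algebraMap_smul]
    exact W.smul_mem c hx
  | ι t => exact hW t
  | mul f g hf hg =>
    intro x hx
    rw [mul_smul]
    exact hf _ (hg x hx)
  | add f g hf hg =>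
    intro x hx
    rw [add_smul]
    exact W.add_mem (hf x hx) (hg x hx)

/-- A subspace that is stable under the generators of a symmetric algebra, as a submodule. -/
def SymmetricAlgebra.submoduleOfι [Module (SymmetricAlgebra k D) T]
    [IsScalarTower k (SymmetricAlgebra k D) T] (W : Submodule k T)
    (hW : ∀ t, ∀ x ∈ W, SymmetricAlgebra.ι k D t • x ∈ W) :
    Submodule (SymmetricAlgebra k D) T where
  carrier := W
  add_mem' := W.add_mem
  zero_mem' := W.zero_mem
  smul_mem' f x hx := SymmetricAlgebra.smul_mem_of_ι_smul_mem hW f x hx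

open scoped IsMulCommutative in
/-- Commuting operators that depend linearly on a vector define a representation of the symmetric
algebra. -/
theorem SymmetricAlgebra.exists_algHom_end (a : D →ₗ[k] Module.End k T)
    (ha : ∀ s t, a s * a t = a t * a s) :
    ∃ ρ : SymmetricAlgebra k D →ₐ[k] Module.End k T, ∀ t, ρ (SymmetricAlgebra.ι k D t) = a t := by
  have hcomm : ∀ x ∈ Set.range a, ∀ y ∈ Set.range a, x * y = y * x := by
    rintro _ ⟨s, rfl⟩ _ ⟨t, rfl⟩
    exact ha s t
  -- The universal property of the symmetric algebra needs a commutative target, so the lift is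
  -- taken in the subalgebra generated by the operators.
  have := Algebra.isMulCommutative_adjoin k hcomm
  let a' : D →ₗ[k] Algebra.adjoin k (Set.range a) :=
    a.codRestrict (Subalgebra.toSubmodule (Algebra.adjoin k (Set.range a)))
      fun t => Algebra.subset_adjoin ⟨t, rfl⟩
  refine ⟨(Algebra.adjoin k (Set.range a)).val.comp (SymmetricAlgebra.lift a'), fun t => ?_⟩
  change ((SymmetricAlgebra.lift a' (SymmetricAlgebra.ι k D t) : Algebra.adjoin k (Set.range a)) :
    Module.End k T) = a t
  rw [SymmetricAlgebra.lift_ι_apply]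
  rfl

end SymmetricAlgebraModules

/-! ### Graded submodules of a direct sum and the Noetherian condition -/

section GradedSubspaces

variable {k : Type u} [Field k] {V : ℕ → Type w} [∀ n, AddCommGroup (V n)] [∀ n, Module k (V n)]

/-- The operator on `⨁ n, V n` given by maps `V n → V (n + 1)`. -/
def shiftMap : (∀ n, V n →ₗ[k] V (n + 1)) →ₗ[k] Module.End k (⨁ n, V n) where
  toFun f := DirectSum.toModule k ℕ _ fun n => DirectSum.lof k ℕ V (n + 1) ∘ₗ f n
  map_add' f g := by
    refine DirectSum.linearMap_ext k fun n => LinearMap.ext fun x => ?_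
    simp [DirectSum.toModule_lof]
  map_smul' c f := by
    refine DirectSum.linearMap_ext k fun n => LinearMap.ext fun x => ?_
    simp [DirectSum.toModule_lof]

theorem shiftMap_lof (f : ∀ n, V n →ₗ[k] V (n + 1)) (n : ℕ) (x : V n) :
    shiftMap f (DirectSum.lof k ℕ V n x) = DirectSum.lof k ℕ V (n + 1) (f n x) :=
  DirectSum.toModule_lof k n x

/-- The subspace of `⨁ n, V n` with the given homogeneous components. -/
def gradedSubspace (N : ∀ n, Submodule k (V n)) : Submodule k (⨁ n, V n) :=
  ⨆ n, (N n).map (DirectSum.lof k ℕ V n)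

theorem lof_mem_gradedSubspace {N : ∀ n, Submodule k (V n)} {n : ℕ} {x : V n} :
    DirectSum.lof k ℕ V n x ∈ gradedSubspace N ↔ x ∈ N n := by
  refine ⟨fun h => ?_, fun h => Submodule.mem_iSup_of_mem n ⟨x, h, rfl⟩⟩
  have hle : gradedSubspace N ≤ (N n).comap (DirectSum.component k ℕ V n) := by
    refine iSup_le fun m => ?_
    rintro _ ⟨z, hz, rfl⟩
    rw [Submodule.mem_comap]
    by_cases hmn : m = n
    · subst hmn
      rw [DirectSum.component.lof_self]
      exact hz
    · rw [DirectSum.component.of, dif_neg hmn]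
      exact zero_mem _
  have := hle h
  rwa [Submodule.mem_comap, DirectSum.component.lof_self] at this

variable {s : ℕ} (y : Fin s → ∀ n, V n →ₗ[k] V (n + 1))

/-- The stable graded subspace generated by the pieces of `N` of degree at most `m`. -/
def truncFamily (N : ∀ n, Submodule k (V n)) (m : ℕ) : ∀ n, Submodule k (V n)
  | 0 => N 0
  | n + 1 => if n + 1 ≤ m then N (n + 1) else ⨆ i, (truncFamily N m n).map (y i n)

theorem truncFamily_of_le (N : ∀ n, Submodule k (V n)) {m n : ℕ} (h : n ≤ m) :
    truncFamily y N m n = N n := by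
  cases n with
  | zero => rfl
  | succ n => rw [truncFamily, if_pos h]

theorem truncFamily_le {N : ∀ n, Submodule k (V n)} (hN : IsStableFamily y N) (m n : ℕ) :
    truncFamily y N m n ≤ N n := by
  induction n with
  | zero => exact le_rfl
  | succ n ih =>
    rw [truncFamily]
    split_ifs
    · exact le_rfl
    · exact iSup_le fun i => Submodule.map_le_iff_le_comap.2 (ih.trans (hN i n))

theorem isStableFamily_truncFamily {N : ∀ n, Submodule k (V n)} (hN : IsStableFamily y N) (m : ℕ) :
    IsStableFamily y (truncFamily y N m) := by
  intro i n
  rw [truncFamily]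
  split_ifs
  · exact (truncFamily_le y hN m n).trans (hN i n)
  · exact Submodule.map_le_iff_le_comap.1 (le_iSup (fun i => (truncFamily y N m n).map (y i n)) i)

theorem truncFamily_mono {N : ∀ n, Submodule k (V n)} (hN : IsStableFamily y N) {m m' : ℕ}
    (h : m ≤ m') (n : ℕ) : truncFamily y N m n ≤ truncFamily y N m' n := by
  induction n with
  | zero => exact le_rfl
  | succ n ih =>
    by_cases h' : n + 1 ≤ m'
    · rw [truncFamily_of_le y N h']
      exact truncFamily_le y hN m _
    · rw [truncFamily, truncFamily, if_neg h', if_neg (by omega)]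
      exact iSup_mono fun i => Submodule.map_mono ih

theorem gradedSubspace_mono {N N' : ∀ n, Submodule k (V n)} (h : ∀ n, N n ≤ N' n) :
    gradedSubspace N ≤ gradedSubspace N' :=
  iSup_mono fun n => Submodule.map_mono (h n)

/-- Noetherianity of `⨁ n, V n` over a symmetric algebra whose generators act with degree one. -/
theorem stableFamiliesFG_of_isNoetherian {D : Type v} [AddCommGroup D] [Module k D]
    (b : Module.Basis (Fin s) k D) (act : D →ₗ[k] ∀ n, V n →ₗ[k] V (n + 1))
    [Module (SymmetricAlgebra k D) (⨁ n, V n)]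
    [IsScalarTower k (SymmetricAlgebra k D) (⨁ n, V n)]
    [IsNoetherian (SymmetricAlgebra k D) (⨁ n, V n)]
    (hact : ∀ t n x, SymmetricAlgebra.ι k D t • DirectSum.lof k ℕ V n x
      = DirectSum.lof k ℕ V (n + 1) (act t n x)) :
    StableFamiliesFG fun i => act (b i) := by
  intro N hN
  set y : Fin s → ∀ n, V n →ₗ[k] V (n + 1) := fun i => act (b i)
  have hstable : ∀ N' : ∀ n, Submodule k (V n), IsStableFamily y N' →
      ∀ t, ∀ x ∈ gradedSubspace N', SymmetricAlgebra.ι k D t • x ∈ gradedSubspace N' := by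
    intro N' hN' t x hx
    refine Submodule.iSup_induction (motive := fun x => SymmetricAlgebra.ι k D t • x ∈
      gradedSubspace N') _ hx ?_ ?_ ?_
    · rintro n _ ⟨z, hz, rfl⟩
      rw [hact, lof_mem_gradedSubspace, ← b.sum_repr t, map_sum, Finset.sum_apply,
        LinearMap.sum_apply]
      refine Submodule.sum_mem _ fun i _ => ?_
      rw [map_smul]
      exact Submodule.smul_mem _ _ (hN' i n hz)
    · rw [smul_zero]
      exact zero_mem _
    · intro x x' hx hx'
      rw [smul_add]
      exact add_mem hx hx'
  -- The submodules generated by the pieces of `N` in degrees at most `m` form an ascending chain.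
  -- Once it is stationary, the piece of degree `n + 1` is already generated by the one of degree
  -- `n`.
  let W : ℕ →o Submodule (SymmetricAlgebra k D) (⨁ n, V n) :=
    ⟨fun m => SymmetricAlgebra.submoduleOfι (gradedSubspace (truncFamily y N m))
      (hstable _ (isStableFamily_truncFamily y hN m)),
      fun m m' h => gradedSubspace_mono (truncFamily_mono y hN h)⟩
  obtain ⟨m₀, hm₀⟩ := monotone_stabilizes_iff_noetherian.2
    (inferInstanceAs (IsNoetherian (SymmetricAlgebra k D) (⨁ n, V n))) W
  refine Filter.eventually_atTop.2 ⟨m₀, fun n hn x hx => ?_⟩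
  have h1 : DirectSum.lof k ℕ V (n + 1) x ∈ W (n + 1) :=
    lof_mem_gradedSubspace.2 (by rwa [truncFamily_of_le y N le_rfl])
  rw [← hm₀ (n + 1) (by omega), hm₀ n hn] at h1
  have h2 : x ∈ truncFamily y N n (n + 1) := lof_mem_gradedSubspace.1 h1
  rwa [truncFamily, if_neg (by omega), truncFamily_of_le y N le_rfl] at h2

end GradedSubspaces

/-! ### Subquotients of copies of ⨁ Sym^n(U)^{⊗d} -/

section MultiplicationSystems

variable {k : Type u} {U : Type v} [Field k] [AddCommGroup U] [Module k U]
  {κ : Type} (b : Module.Basis κ k U) {d : ℕ} {J : Type}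
  {V : ℕ → Type w} [∀ n, AddCommGroup (V n)] [∀ n, Module k (V n)]

/-- A presentation of the spaces `V n` as subquotients of `J → multiDeg k κ d n`, through the
relations `Q n`, such that the maps `A u n` are induced by multiplication by `u ⊗ ⋯ ⊗ u`. -/
structure IsMultiplicationSystem (A : U → ∀ n, V n →ₗ[k] V (n + 1))
    (Q : ∀ n, Submodule k ((J → MvPolynomial (Fin d × κ) k) × V n)) : Prop where
  mem_multiDeg : ∀ n m v, (m, v) ∈ Q n → ∀ j, m j ∈ multiDeg k κ d n
  eq_zero : ∀ n v, (0, v) ∈ Q n → v = 0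
  exists_mem : ∀ n v, ∃ m, (m, v) ∈ Q n
  mul_mem : ∀ u n m v, (m, v) ∈ Q n →
    (prodPullLinear b d (dpow k d u) • m, A u n v) ∈ Q (n + 1)

namespace IsMultiplicationSystem

variable {b} {A : U → ∀ n, V n →ₗ[k] V (n + 1)}
  {Q : ∀ n, Submodule k ((J → MvPolynomial (Fin d × κ) k) × V n)}

/-- The maps `A u` extend to formal combinations of vectors, and the extension `L c` is induced by
multiplication by the polynomial of `P c`. If `P c = 0` this is multiplication by zero, so `L c = 0`
by `eq_zero`. Hence `L` factors through `P`, which is onto since the divided powers span. -/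
theorem exists_linearMap [Infinite k] [Fintype κ] (h : IsMultiplicationSystem b A Q) :
    ∃ act : dividedPower k U d →ₗ[k] ∀ n, V n →ₗ[k] V (n + 1), ∀ u, act (dpow k d u) = A u := by
  let L : (U →₀ k) →ₗ[k] ∀ n, V n →ₗ[k] V (n + 1) := Finsupp.linearCombination k A
  let P : (U →₀ k) →ₗ[k] dividedPower k U d := Finsupp.linearCombination k (dpow k d)
  have hP : LinearMap.range P = ⊤ := by
    rw [Finsupp.range_linearCombination, span_range_dpow b]
  have key : ∀ c n m v, (m, v) ∈ Q n → (prodPullLinear b d (P c) • m, L c n v) ∈ Q (n + 1) := by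
    intro c n m v hmv
    induction c using Finsupp.induction_linear with
    | zero =>
      convert (Q (n + 1)).zero_mem using 1
      simp
    | add c c' hc hc' =>
      have := (Q (n + 1)).add_mem hc hc'
      simpa only [map_add, add_smul, Pi.add_apply, LinearMap.add_apply, Prod.mk_add_mk] using this
    | single u a =>
      have := (Q (n + 1)).smul_mem a (h.mul_mem u n m v hmv)
      simpa only [P, L, Finsupp.linearCombination_single, map_smul, smul_assoc, Prod.smul_mk,
        Pi.smul_apply, LinearMap.smul_apply] using this
  obtain ⟨s, hs⟩ := P.exists_rightInverse_of_surjective hP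
  refine ⟨L ∘ₗ s, fun u => ?_⟩
  have h0 : ∀ c, P c = 0 → L c = 0 := by
    intro c hc
    funext n
    refine LinearMap.ext fun v => ?_
    obtain ⟨m, hm⟩ := h.exists_mem n v
    have := key c n m v hm
    rw [hc, map_zero, zero_smul] at this
    exact h.eq_zero _ _ this
  have h1 : L (s (dpow k d u) - Finsupp.single u 1) = 0 := by
    refine h0 _ ?_
    rw [map_sub, sub_eq_zero]
    refine (LinearMap.congr_fun hs (dpow k d u)).trans ?_
    simp [P]
  rw [map_sub, sub_eq_zero] at h1
  rw [LinearMap.comp_apply, h1]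
  simp [L]

theorem linearMap_mem [Infinite k] [Fintype κ] (h : IsMultiplicationSystem b A Q)
    {act : dividedPower k U d →ₗ[k] ∀ n, V n →ₗ[k] V (n + 1)} (hact : ∀ u, act (dpow k d u) = A u)
    (t : dividedPower k U d) {n : ℕ} {m : J → MvPolynomial (Fin d × κ) k} {v : V n}
    (hmv : (m, v) ∈ Q n) : (prodPullLinear b d t • m, act t n v) ∈ Q (n + 1) := by
  have ht : t ∈ Submodule.span k (Set.range (dpow k (U := U) d)) := by
    rw [span_range_dpow b]
    trivial
  induction ht using Submodule.span_induction with
  | mem t ht =>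
    obtain ⟨u, rfl⟩ := ht
    rw [hact]
    exact h.mul_mem u n m v hmv
  | zero =>
    convert (Q (n + 1)).zero_mem using 1
    simp
  | add t t' _ _ ht ht' =>
    have := (Q (n + 1)).add_mem ht ht'
    simpa only [map_add, add_smul, Pi.add_apply, LinearMap.add_apply, Prod.mk_add_mk] using this
  | smul a t _ ht =>
    have := (Q (n + 1)).smul_mem a ht
    simpa only [map_smul, smul_assoc, Prod.smul_mk, Pi.smul_apply, LinearMap.smul_apply] using this

/-- Both composites are induced by multiplication by the same product of polynomials, so their
difference is related to 0. -/
theorem linearMap_comm [Infinite k] [Fintype κ] (h : IsMultiplicationSystem b A Q)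
    {act : dividedPower k U d →ₗ[k] ∀ n, V n →ₗ[k] V (n + 1)} (hact : ∀ u, act (dpow k d u) = A u)
    (t t' : dividedPower k U d) (n : ℕ) (v : V n) :
    act t (n + 1) (act t' n v) = act t' (n + 1) (act t n v) := by
  obtain ⟨m, hm⟩ := h.exists_mem n v
  have h1 := (Q (n + 2)).sub_mem (h.linearMap_mem hact t (h.linearMap_mem hact t' hm))
    (h.linearMap_mem hact t' (h.linearMap_mem hact t hm))
  rw [smul_smul, smul_smul, mul_comm, Prod.mk_sub_mk, sub_self] at h1
  exact sub_eq_zero.1 (h.eq_zero _ _ h1)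

/-- The action of `Sym(D^d U)` on `⨁ n, V n`. -/
theorem exists_algHom [Infinite k] [Fintype κ] (h : IsMultiplicationSystem b A Q) :
    ∃ ρ : SymmetricAlgebra k (dividedPower k U d) →ₐ[k] Module.End k (⨁ n, V n),
      ∀ u n x, ρ (SymmetricAlgebra.ι k _ (dpow k d u)) (DirectSum.lof k ℕ V n x)
        = DirectSum.lof k ℕ V (n + 1) (A u n x) := by
  obtain ⟨act, hact⟩ := h.exists_linearMap
  obtain ⟨ρ, hρ⟩ := SymmetricAlgebra.exists_algHom_end (shiftMap ∘ₗ act) fun t t' => by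
    refine DirectSum.linearMap_ext k fun n => LinearMap.ext fun x => ?_
    simp only [LinearMap.comp_apply, Module.End.mul_apply, shiftMap_lof]
    rw [h.linearMap_comm hact]
  refine ⟨ρ, fun u n x => ?_⟩
  rw [hρ, LinearMap.comp_apply, shiftMap_lof, hact]

theorem algHom_eq [Infinite k] [Fintype κ] (b : Module.Basis κ k U)
    {ρ ρ' : SymmetricAlgebra k (dividedPower k U d) →ₐ[k] Module.End k (⨁ n, V n)}
    (hρ : ∀ u n x, ρ (SymmetricAlgebra.ι k _ (dpow k d u)) (DirectSum.lof k ℕ V n x)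
        = DirectSum.lof k ℕ V (n + 1) (A u n x))
    (hρ' : ∀ u n x, ρ' (SymmetricAlgebra.ι k _ (dpow k d u)) (DirectSum.lof k ℕ V n x)
        = DirectSum.lof k ℕ V (n + 1) (A u n x)) : ρ = ρ' := by
  have : ρ.toLinearMap ∘ₗ SymmetricAlgebra.ι k (dividedPower k U d)
      = ρ'.toLinearMap ∘ₗ SymmetricAlgebra.ι k (dividedPower k U d) := by
    refine LinearMap.ext_on_range (v := dpow k d) (span_range_dpow b d) fun u => ?_
    refine DirectSum.linearMap_ext k fun n => LinearMap.ext fun x => ?_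
    exact (hρ u n x).trans (hρ' u n x).symm
  refine AlgHom.ext fun f => ?_
  induction f using SymmetricAlgebra.induction with
  | algebraMap c => rw [AlgHom.commutes, AlgHom.commutes]
  | ι t => exact LinearMap.congr_fun this t
  | mul f g hf hg => rw [map_mul, map_mul, hf, hg]
  | add f g hf hg => rw [map_add, map_add, hf, hg]

theorem algHom_ι_lof [Infinite k] [Fintype κ] (b : Module.Basis κ k U)
    {ρ : SymmetricAlgebra k (dividedPower k U d) →ₐ[k] Module.End k (⨁ n, V n)}
    (hρ : ∀ u n x, ρ (SymmetricAlgebra.ι k _ (dpow k d u)) (DirectSum.lof k ℕ V n x)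
        = DirectSum.lof k ℕ V (n + 1) (A u n x))
    {act : dividedPower k U d →ₗ[k] ∀ n, V n →ₗ[k] V (n + 1)} (hact : ∀ u, act (dpow k d u) = A u)
    (t : dividedPower k U d) (n : ℕ) (x : V n) :
    ρ (SymmetricAlgebra.ι k _ t) (DirectSum.lof k ℕ V n x)
      = DirectSum.lof k ℕ V (n + 1) (act t n x) := by
  have : ρ.toLinearMap ∘ₗ SymmetricAlgebra.ι k (dividedPower k U d) = shiftMap ∘ₗ act := by
    refine LinearMap.ext_on_range (v := dpow k d) (span_range_dpow b d) fun u => ?_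
    refine DirectSum.linearMap_ext k fun n => LinearMap.ext fun x => ?_
    simp only [LinearMap.comp_apply, AlgHom.toLinearMap_apply, hρ, shiftMap_lof, hact]
  exact (LinearMap.congr_fun (LinearMap.congr_fun this t) _).trans (shiftMap_lof _ _ _)

/-- The inclusion of the degree `n` pieces in the direct sum. -/
def homogeneousIncl (k : Type u) [Field k] (κ : Type) (d : ℕ) (J : Type) (V : ℕ → Type w)
    [∀ n, AddCommGroup (V n)] [∀ n, Module k (V n)] (n : ℕ) :
    (J → MvPolynomial (Fin d × κ) k) × V n →ₗ[k]
      (J → Polynomial (MvPolynomial (Fin d × κ) k)) × ⨁ n, V n :=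
  LinearMap.prodMap (((Polynomial.monomial n).restrictScalars k).compLeft J)
    (DirectSum.lof k ℕ V n)

/-- The projection of the direct sum to the degree `n` pieces. -/
def homogeneousProj (k : Type u) [Field k] (κ : Type) (d : ℕ) (J : Type) (V : ℕ → Type w)
    [∀ n, AddCommGroup (V n)] [∀ n, Module k (V n)] (n : ℕ) :
    (J → Polynomial (MvPolynomial (Fin d × κ) k)) × (⨁ n, V n) →ₗ[k]
      (J → MvPolynomial (Fin d × κ) k) × V n :=
  LinearMap.prodMap (((Polynomial.lcoeff _ n).restrictScalars k).compLeft J)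
    (DirectSum.component k ℕ V n)

theorem homogeneousProj_incl (n n' : ℕ)
    (Q : ∀ n, Submodule k ((J → MvPolynomial (Fin d × κ) k) × V n))
    (x) (hx : x ∈ Q n') :
    homogeneousProj k κ d J V n (homogeneousIncl k κ d J V n' x) ∈ Q n := by
  by_cases h : n' = n
  · subst h
    convert hx using 1
    refine Prod.ext (funext fun j => ?_) ?_
    · simp [homogeneousProj, homogeneousIncl]
    · simp [homogeneousProj, homogeneousIncl, DirectSum.component.lof_self]
  · convert (Q n).zero_mem using 1
    refine Prod.ext (funext fun j => ?_) ?_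
    · simp [homogeneousProj, homogeneousIncl, Polynomial.coeff_monomial, h]
    · simp [homogeneousProj, homogeneousIncl, DirectSum.component.of, h]

/-- The action on `⨁ n, V n` is finitely generated and annihilated by the ideal of the Chow
variety. -/
theorem finite_and_annihilator [IsAlgClosed k] [Fintype κ] [Finite J]
    (h : IsMultiplicationSystem b A Q)
    (ρ : SymmetricAlgebra k (dividedPower k U d) →ₐ[k] Module.End k (⨁ n, V n))
    (hρ : ∀ u n x, ρ (SymmetricAlgebra.ι k _ (dpow k d u)) (DirectSum.lof k ℕ V n x)
        = DirectSum.lof k ℕ V (n + 1) (A u n x)) :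
    letI : Module (SymmetricAlgebra k (dividedPower k U d)) (⨁ n, V n) :=
      Module.compHom _ ρ.toRingHom
    IsNoetherian (SymmetricAlgebra k (dividedPower k U d)) (⨁ n, V n) ∧
      chowIdeal k U d
        ≤ Module.annihilator (SymmetricAlgebra k (dividedPower k U d)) (⨁ n, V n) := by
  have : Infinite k := IsAlgClosed.instInfinite
  have : FiniteDimensional k (⨂[k] _ : Fin d, U) :=
    Module.Finite.of_basis (Basis.piTensorProduct fun _ => b)
  have := SymmetricAlgebra.isNoetherianRing (k := k) (D := dividedPower k U d)
  let _ := prodPullModule b d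
  let _ : Module (SymmetricAlgebra k (dividedPower k U d)) (⨁ n, V n) :=
      Module.compHom _ ρ.toRingHom
  have : IsScalarTower k (SymmetricAlgebra k (dividedPower k U d))
      (Polynomial (MvPolynomial (Fin d × κ) k)) :=
    ⟨fun c f p => by
      change prodPull b d (c • f) * p = c • (prodPull b d f * p)
      rw [map_smul, smul_mul_assoc]⟩
  have : IsScalarTower k (SymmetricAlgebra k (dividedPower k U d)) (⨁ n, V n) :=
    ⟨fun c f x => by
      change ρ (c • f) x = c • ρ f x
      rw [map_smul, LinearMap.smul_apply]⟩
  obtain ⟨act, hact⟩ := h.exists_linearMap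
  -- The direct sum of the relations `Q n`. It is stable under the action, lies over a finitely
  -- generated module of polynomials, is determined by its polynomial component and surjects onto `⨁
  -- n, V n`. So Noetherianity and annihilation by the ideal pass from polynomials to `Z`, and on to
  -- the direct sum.
  let Z₀ : Submodule k ((J → Polynomial (MvPolynomial (Fin d × κ) k)) × ⨁ n, V n) :=
    ⨆ n, (Q n).map (homogeneousIncl k κ d J V n)
  have hZ₀ : ∀ n x, x ∈ Q n → homogeneousIncl k κ d J V n x ∈ Z₀ := fun n x hx =>
    Submodule.mem_iSup_of_mem n ⟨x, hx, rfl⟩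
  let Z := SymmetricAlgebra.submoduleOfι (D := dividedPower k U d) Z₀ (by
    intro t x hx
    refine Submodule.iSup_induction (motive := fun x => SymmetricAlgebra.ι k _ t • x ∈ Z₀) _ hx
      ?_ ?_ ?_
    · rintro n _ ⟨⟨m, v⟩, hz, rfl⟩
      convert hZ₀ (n + 1) _ (h.linearMap_mem hact t hz) using 1
      refine Prod.ext (funext fun j => ?_) ?_
      · change prodPull b d (SymmetricAlgebra.ι k _ t) * Polynomial.monomial n (m j)
          = Polynomial.monomial (n + 1) (prodPullLinear b d t * m j)
        rw [prodPull_ι, Polynomial.monomial_mul_monomial, add_comm 1 n]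
      · exact algHom_ι_lof b hρ hact t n v
    · rw [smul_zero]
      exact zero_mem _
    · intro x x' hx hx'
      rw [smul_add]
      exact add_mem hx hx')
  have hproj : ∀ n, ∀ x ∈ Z, homogeneousProj k κ d J V n x ∈ Q n := by
    intro n
    suffices hle : Z₀ ≤ (Q n).comap (homogeneousProj k κ d J V n) from fun x hx => hle hx
    refine iSup_le fun n' => ?_
    rintro _ ⟨x, hx, rfl⟩
    exact homogeneousProj_incl n n' Q x hx
  have hinj : ∀ x ∈ Z, x.1 = 0 → x.2 = 0 := by
    rintro ⟨m, x⟩ hx hm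
    -- Homogeneous components of an element of `Z` lie in the `Q n`, so `eq_zero` applies degree by
    -- degree.
    refine DFinsupp.ext fun n => h.eq_zero n _ ?_
    have h1 := hproj n _ hx
    convert h1 using 1
    refine Prod.ext (funext fun j => ?_) rfl
    have hm' : m = 0 := hm
    simp [homogeneousProj, hm']
  have hsurj : ∀ x : ⨁ n, V n, ∃ m, (m, x) ∈ Z := by
    intro x
    have hx : x ∈ Z₀.map (LinearMap.snd k _ _) := by
      induction x using DirectSum.induction_on with
      | zero => exact zero_mem _
      | of n v =>
        obtain ⟨m, hm⟩ := h.exists_mem n v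
        exact ⟨_, hZ₀ n _ hm, rfl⟩
      | add x y hx hy => exact add_mem hx hy
    obtain ⟨⟨m, x'⟩, hz, rfl⟩ := hx
    exact ⟨m, hz⟩
  obtain ⟨S, hS, hSmem⟩ := exists_fg_multiDeg_le b d
  have hfst : ∀ x ∈ Z, ∀ j, x.1 j ∈ S := by
    intro x hx j
    refine Submodule.iSup_induction (motive := fun x => x.1 j ∈ S) _ hx ?_ (zero_mem _)
      fun x y hx hy => add_mem hx hy
    rintro n _ ⟨⟨m, v⟩, hz, rfl⟩
    exact hSmem n _ (h.mem_multiDeg n m v hz j)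
  have : IsNoetherian (SymmetricAlgebra k (dividedPower k U d)) Z :=
    isNoetherian_of_fst_mem hS hfst hinj
  refine ⟨isNoetherian_of_surjective (LinearMap.snd _ _ _ ∘ₗ Z.subtype) ?_, fun f hf => ?_⟩
  · rw [LinearMap.range_eq_top]
    intro x
    obtain ⟨m, hm⟩ := hsurj x
    exact ⟨⟨_, hm⟩, rfl⟩
  · rw [Module.mem_annihilator]
    intro x
    obtain ⟨m, hm⟩ := hsurj x
    -- Lift `x` to `Z`: there `f` kills the polynomial component, hence also the second one.
    refine hinj _ (Z.smul_mem f hm) (funext fun j => ?_)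
    change prodPull b d f * m j = 0
    rw [prodPull_eq_zero_of_mem_chowIdeal b d hf, zero_mul]

theorem finite_and_support [IsAlgClosed k] [Fintype κ] [Finite J]
    (h : IsMultiplicationSystem b A Q)
    (ρ : SymmetricAlgebra k (dividedPower k U d) →ₐ[k] Module.End k (⨁ n, V n))
    (hρ : ∀ u n x, ρ (SymmetricAlgebra.ι k _ (dpow k d u)) (DirectSum.lof k ℕ V n x)
        = DirectSum.lof k ℕ V (n + 1) (A u n x)) :
    letI : Module (SymmetricAlgebra k (dividedPower k U d)) (⨁ n, V n) :=
      Module.compHom _ ρ.toRingHom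
    Module.Finite (SymmetricAlgebra k (dividedPower k U d)) (⨁ n, V n) ∧
      Module.support (SymmetricAlgebra k (dividedPower k U d)) (⨁ n, V n) ⊆
        PrimeSpectrum.zeroLocus
          (chowIdeal k U d : Set (SymmetricAlgebra k (dividedPower k U d))) := by
  let _ : Module (SymmetricAlgebra k (dividedPower k U d)) (⨁ n, V n) :=
      Module.compHom _ ρ.toRingHom
  obtain ⟨hN, hle⟩ := h.finite_and_annihilator ρ hρ
  exact ⟨Module.IsNoetherian.finite _ _,
    fun p hp => hle.trans (Module.annihilator_le_of_mem_support hp)⟩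

/-- The projection of `Q n` to `J → multiDeg k κ d n`. -/
theorem exists_injective (h : IsMultiplicationSystem b A Q) (n : ℕ) :
    ∃ F : Q n →ₗ[k] J → multiDeg k κ d n, Function.Injective F := by
  refine ⟨LinearMap.pi fun j => LinearMap.codRestrict (multiDeg k κ d n)
      (LinearMap.proj j ∘ₗ LinearMap.fst _ _ _ ∘ₗ (Q n).subtype) fun x =>
        h.mem_multiDeg n x.1.1 x.1.2 x.2 j, ?_⟩
  rw [← LinearMap.ker_eq_bot, LinearMap.ker_eq_bot']
  rintro ⟨⟨m, v⟩, hx⟩ h0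
  have h1 : m = 0 := funext fun j => congrArg Subtype.val (congrFun h0 j)
  subst h1
  exact Subtype.ext (Prod.ext rfl (h.eq_zero n v hx))

theorem snd_surjective (h : IsMultiplicationSystem b A Q) (n : ℕ) :
    Function.Surjective (LinearMap.snd k _ _ ∘ₗ (Q n).subtype) := fun v => by
  obtain ⟨m, hm⟩ := h.exists_mem n v
  exact ⟨⟨_, hm⟩, rfl⟩

theorem finiteDimensional [Fintype κ] [Finite J] (h : IsMultiplicationSystem b A Q) (n : ℕ) :
    FiniteDimensional k (V n) := by
  obtain ⟨F, hF⟩ := h.exists_injective n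
  have := finiteDimensional_multiDeg (k := k) (κ := κ) d n
  have := FiniteDimensional.of_injective F hF
  exact Module.Finite.of_surjective _ (h.snd_surjective n)

theorem finrank_le [Fintype κ] [Fintype J] (h : IsMultiplicationSystem b A Q) (n : ℕ) :
    Module.finrank k (V n) ≤ Fintype.card J * Module.finrank k (multiDeg k κ d n) := by
  obtain ⟨F, hF⟩ := h.exists_injective n
  have := finiteDimensional_multiDeg (k := k) (κ := κ) d n
  have := FiniteDimensional.of_injective F hF
  calc _ ≤ Module.finrank k (Q n) := LinearMap.finrank_le_finrank_of_surjective (h.snd_surjective n)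
    _ ≤ Module.finrank k (J → multiDeg k κ d n) := LinearMap.finrank_le_finrank_of_injective hF
    _ = _ := by rw [Module.finrank_pi_fintype]; simp

theorem eventuallyPolynomial [IsAlgClosed k] [Fintype κ] [Finite J]
    (h : IsMultiplicationSystem b A Q) :
    EventuallyPolynomial fun n => Module.finrank k (V n) := by
  have : Infinite k := IsAlgClosed.instInfinite
  have : FiniteDimensional k (⨂[k] _ : Fin d, U) :=
    Module.Finite.of_basis (Basis.piTensorProduct fun _ => b)
  obtain ⟨act, hact⟩ := h.exists_linearMap
  obtain ⟨ρ, hρ⟩ := h.exists_algHom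
  let _ : Module (SymmetricAlgebra k (dividedPower k U d)) (⨁ n, V n) :=
      Module.compHom _ ρ.toRingHom
  have : IsScalarTower k (SymmetricAlgebra k (dividedPower k U d)) (⨁ n, V n) :=
    ⟨fun c f x => by
      change ρ (c • f) x = c • ρ f x
      rw [map_smul, LinearMap.smul_apply]⟩
  have : IsNoetherian (SymmetricAlgebra k (dividedPower k U d)) (⨁ n, V n) :=
    (h.finite_and_annihilator ρ hρ).1
  have := h.finiteDimensional
  exact eventuallyPolynomial_finrank _ (fun i j n x => h.linearMap_comm hact _ _ n x)
    (stableFamiliesFG_of_isNoetherian (Module.finBasis k (dividedPower k U d)) act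
      fun t n x => algHom_ι_lof b hρ hact t n x)

theorem exists_polynomial [IsAlgClosed k] [Fintype κ] [Finite J]
    (h : IsMultiplicationSystem b A Q) :
    ∃ P : Polynomial ℚ, (P = 0 ∨ (P.natDegree : ℤ) ≤ ((Fintype.card κ : ℤ) - 1) * d) ∧
      ∀ᶠ n : ℕ in Filter.atTop, (Module.finrank k (V n) : ℚ) = P.eval (n : ℚ) := by
  obtain ⟨P, hP⟩ := h.eventuallyPolynomial
  have := Fintype.ofFinite J
  refine ⟨P, ?_, hP⟩
  have hdeg : P.natDegree ≤ (Fintype.card κ - 1) * d :=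
    Polynomial.natDegree_le_of_eventually_le hP fun n =>
      (h.finrank_le n).trans (Nat.mul_le_mul_left _ (finrank_multiDeg_le d n))
  -- If U = 0 the bound is -d. For `d = 0` this is 0 and agrees with the truncated bound; for `d >
  -- 0` the spaces vanish in positive degrees and `P` is zero.
  rcases isEmpty_or_nonempty κ with hκ | hκ
  · by_cases hd : d = 0
    · subst hd
      right
      simpa using hdeg
    · left
      refine Polynomial.eq_zero_of_infinite_isRoot P ?_
      obtain ⟨N, hN⟩ := Filter.eventually_atTop.1 hP
      refine Set.infinite_of_injective_forall_mem (f := fun n : ℕ => ((N + n + 1 : ℕ) : ℚ))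
        (fun a a' haa => by simpa using haa) fun n => ?_
      have h1 : (Module.finrank k (V (N + n + 1)) : ℚ) = _ := hN (N + n + 1) (by omega)
      have h2 := h.finrank_le (N + n + 1)
      rw [finrank_multiDeg_eq_zero d hd (by omega), mul_zero, Nat.le_zero] at h2
      rw [h2, Nat.cast_zero] at h1
      exact h1.symm
  · right
    have h1 : 1 ≤ Fintype.card κ := Fintype.card_pos
    have h2 : (P.natDegree : ℤ) ≤ ((Fintype.card κ - 1) * d : ℕ) := by exact_mod_cast hdeg
    rwa [Nat.cast_mul, Nat.cast_sub h1, Nat.cast_one] at h2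

end IsMultiplicationSystem

end MultiplicationSystems

/-! ### Veronese rings of rings generated in degree one -/

section StandardGraded

theorem LinearMap.range_pow_eq_span {k A V : Type*} [Field k] [CommRing A] [Algebra k A]
    [AddCommGroup V] [Module k V] (f : V →ₗ[k] A) (a : ℕ) :
    LinearMap.range f ^ a = Submodule.span k (Set.range fun x : Fin a → V => ∏ i, f (x i)) := by
  rw [← Submodule.span_eq (LinearMap.range f), Submodule.span_pow]
  congr 1
  ext y
  rw [Set.mem_pow]
  constructor
  · rintro ⟨s, rfl⟩
    choose x hx using fun i => (s i).2
    exact ⟨x, by rw [List.prod_ofFn]; exact Finset.prod_congr rfl fun i _ => hx i⟩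
  · rintro ⟨x, rfl⟩
    exact ⟨fun i => ⟨f (x i), x i, rfl⟩, by rw [List.prod_ofFn]⟩

theorem Submodule.eq_pow_of_eq_pow {k R : Type*} [Field k] [CommRing R] [Algebra k R]
    {𝒜 : ℕ → Submodule k R} {L : Submodule k R} (h : ∀ m, 𝒜 m = L ^ m) (n a : ℕ) :
    𝒜 (a * n) = 𝒜 n ^ a := by
  rw [h, h n, ← pow_mul, mul_comm]

variable {k R : Type u} {U : Type v} [Field k] [AddCommGroup U] [Module k U]
  [CommRing R] [Algebra k R] (𝒜 : ℕ → Submodule k R) [GradedAlgebra 𝒜]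

theorem GradedAlgebra.submodule_pow_le {L : Submodule k R} (hL : L ≤ 𝒜 1) (m : ℕ) :
    L ^ m ≤ 𝒜 m := by
  induction m with
  | zero =>
    rw [pow_zero, Submodule.one_le]
    exact SetLike.GradedOne.one_mem
  | succ m ih =>
    rw [pow_succ, Submodule.mul_le]
    exact fun x hx y hy => SetLike.GradedMul.mul_mem (ih hx) (hL hy)

variable {𝒜}

/-- A graded quotient of `Sym(U)` is generated in degree one. -/
theorem eq_range_pow {π : SymmetricAlgebra k U →ₐ[k] R} (hπ : Function.Surjective π)
    {g : U →ₗ[k] 𝒜 1} (hg : ∀ u, π (SymmetricAlgebra.ι k U u) = g u) (m : ℕ) :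
    𝒜 m = LinearMap.range ((𝒜 1).subtype ∘ₗ g) ^ m := by
  set L := LinearMap.range ((𝒜 1).subtype ∘ₗ g) with hL
  have hL1 : L ≤ 𝒜 1 := by
    rintro _ ⟨u, rfl⟩
    exact (g u).2
  refine le_antisymm (fun x hx => ?_) (GradedAlgebra.submodule_pow_le 𝒜 hL1 m)
  -- The sum of the powers of `L` is closed under products and contains the generators, so it is all
  -- of `R`. As `L ^ m` lies in degree `m`, projecting to degree `m` leaves only `L ^ m`.
  have htop : ∀ f, π f ∈ ⨆ m, L ^ m := by
    intro f
    induction f using SymmetricAlgebra.induction with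
    | algebraMap c =>
      refine Submodule.mem_iSup_of_mem 0 ?_
      rw [AlgHom.commutes, pow_zero]
      exact Submodule.algebraMap_mem c
    | ι u =>
      refine Submodule.mem_iSup_of_mem 1 ?_
      rw [hg, pow_one]
      exact ⟨u, rfl⟩
    | mul f f' hf hf' =>
      rw [map_mul]
      have h := Submodule.mul_mem_mul hf hf'
      rw [Submodule.iSup_mul] at h
      refine (iSup_le fun a => ?_ : (⨆ i, L ^ i * ⨆ m, L ^ m) ≤ ⨆ m, L ^ m) h
      rw [Submodule.mul_iSup]
      refine iSup_le fun b => ?_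
      rw [← pow_add]
      exact le_iSup (fun m => L ^ m) (a + b)
    | add f f' hf hf' =>
      rw [map_add]
      exact add_mem hf hf'
  have hproj : ∀ y ∈ ⨆ m, L ^ m, GradedAlgebra.proj 𝒜 m y ∈ L ^ m := by
    suffices h : (⨆ m, L ^ m) ≤ (L ^ m).comap (GradedAlgebra.proj 𝒜 m) from fun y hy => h hy
    refine iSup_le fun m' y hy => ?_
    have hy' := GradedAlgebra.submodule_pow_le 𝒜 hL1 m' hy
    rw [Submodule.mem_comap, GradedAlgebra.proj_apply]
    by_cases h : m' = m
    · subst h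
      rwa [DirectSum.decompose_of_mem_same 𝒜 hy']
    · rw [DirectSum.decompose_of_mem_ne 𝒜 hy' h]
      exact zero_mem _
  obtain ⟨f, rfl⟩ := hπ x
  have := hproj _ (htop f)
  rwa [GradedAlgebra.proj_apply, DirectSum.decompose_of_mem_same 𝒜 hx] at this

variable (𝒜)

theorem veroneseIncl_congr {n a a' : ℕ} (h : a = a') {y : veronesePiece 𝒜 n a}
    {z : veronesePiece 𝒜 n a'} (hyz : (y : R) = z) :
    veroneseIncl 𝒜 n a y = veroneseIncl 𝒜 n a' z := by
  subst h
  exact congrArg _ (Subtype.ext hyz)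

theorem veroneseIncl_mul (n a a' : ℕ) (y : veronesePiece 𝒜 n a) (z : veronesePiece 𝒜 n a') :
    veroneseIncl 𝒜 n a y * veroneseIncl 𝒜 n a' z
      = veroneseIncl 𝒜 n (a + a') ⟨(y : R) * z, SetLike.GradedMul.mul_mem y.2 z.2⟩ :=
  DirectSum.of_mul_of (A := fun m => ↥(veronesePiece 𝒜 n m)) y z

theorem prod_veroneseOne {n : ℕ} {τ : Type*} (s : Finset τ) (x : τ → 𝒜 n) :
    ∃ h, ∏ i ∈ s, veroneseOne 𝒜 n (x i) = veroneseIncl 𝒜 n s.card ⟨∏ i ∈ s, (x i : R), h⟩ := by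
  classical
  induction s using Finset.induction_on with
  | empty => exact ⟨SetLike.GradedOne.one_mem, rfl⟩
  | insert i s hi ih =>
    obtain ⟨h, e⟩ := ih
    have h1 : (x i : R) ∈ veronesePiece 𝒜 n 1 := by
      rw [veronesePiece, one_mul]
      exact (x i).2
    have hcard : 1 + s.card = (insert i s).card := by
      rw [Finset.card_insert_of_notMem hi, add_comm]
    refine ⟨?_, ?_⟩
    · rw [Finset.prod_insert hi, ← hcard]
      exact SetLike.GradedMul.mul_mem h1 h
    · rw [Finset.prod_insert hi, e]
      refine (veroneseIncl_mul 𝒜 n 1 s.card ⟨x i, h1⟩ _).trans (veroneseIncl_congr 𝒜 hcard ?_)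
      exact (Finset.prod_insert (f := fun i => (x i : R)) hi).symm

theorem veroneseDeg_eq_range_pow {n : ℕ} (a : ℕ) (h : 𝒜 (a * n) = 𝒜 n ^ a) :
    veroneseDeg 𝒜 n a = LinearMap.range (veroneseOne 𝒜 n) ^ a := by
  have hprod : ∀ x : Fin a → 𝒜 n, ∃ h, ∏ i, veroneseOne 𝒜 n (x i)
      = veroneseIncl 𝒜 n a ⟨∏ i, (x i : R), h⟩ := by
    intro x
    obtain ⟨h, e⟩ := prod_veroneseOne 𝒜 Finset.univ x
    have hc : (Finset.univ : Finset (Fin a)).card = a := by simp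
    exact ⟨by rwa [hc] at h, e.trans (veroneseIncl_congr 𝒜 hc rfl)⟩
  refine le_antisymm ?_ ?_
  · rintro _ ⟨⟨y, hy⟩, rfl⟩
    have hy' : y ∈ LinearMap.range (𝒜 n).subtype ^ a := by
      rw [Submodule.range_subtype, ← h]
      exact hy
    rw [LinearMap.range_pow_eq_span] at hy'
    -- The membership proof is part of the element of the piece, so it has to be rebuilt along the
    -- induction over the span.
    suffices H : ∃ hy : y ∈ veronesePiece 𝒜 n a,
        veroneseIncl 𝒜 n a ⟨y, hy⟩ ∈ LinearMap.range (veroneseOne 𝒜 n) ^ a from H.2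
    clear hy
    induction hy' using Submodule.span_induction with
    | mem y hy =>
      obtain ⟨x, rfl⟩ := hy
      obtain ⟨h1, e⟩ := hprod x
      refine ⟨h1, ?_⟩
      rw [LinearMap.range_pow_eq_span]
      exact Submodule.subset_span ⟨x, e⟩
    | zero => exact ⟨zero_mem _, by
        convert zero_mem (LinearMap.range (veroneseOne 𝒜 n) ^ a) using 1
        exact map_zero _⟩
    | add y z _ _ hy hz =>
      obtain ⟨h1, e1⟩ := hy
      obtain ⟨h2, e2⟩ := hz
      refine ⟨add_mem h1 h2, ?_⟩
      convert add_mem e1 e2 using 1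
      exact map_add (veroneseIncl 𝒜 n a) ⟨y, h1⟩ ⟨z, h2⟩
    | smul c y _ hy =>
      obtain ⟨h1, e1⟩ := hy
      refine ⟨Submodule.smul_mem _ c h1, ?_⟩
      convert Submodule.smul_mem _ c e1 using 1
      exact map_smul (veroneseIncl 𝒜 n a) c ⟨y, h1⟩
  · rw [LinearMap.range_pow_eq_span, Submodule.span_le]
    rintro _ ⟨x, rfl⟩
    obtain ⟨h1, e⟩ := hprod x
    exact ⟨_, e.symm⟩

end StandardGraded

/-! ### Multilinear generation of the bar complex -/

section MultilinearGeneration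

variable {k R : Type u} {U : Type v} [Field k] [AddCommGroup U] [Module k U]
  [CommRing R] [Algebra k R] {𝒜 : ℕ → Submodule k R} [GradedAlgebra 𝒜]

/-- The subspaces `G n` are spanned by the values of finitely many families of `d`-linear maps on
`R_n` that turn multiplication by `u` into the maps `β u n`. -/
def MultilinearlyGenerated (g : U →ₗ[k] 𝒜 1) (d : ℕ) {E : ℕ → Type u} [∀ n, AddCommGroup (E n)]
    [∀ n, Module k (E n)] (G : ∀ n, Submodule k (E n)) (β : U → ∀ n, E n →ₗ[k] E (n + 1)) : Prop :=
  ∃ (J : Type) (_ : Finite J) (Ψ : J → ∀ n, MultilinearMap k (fun _ : Fin d => 𝒜 n) (E n)),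
    (∀ u j n x, β u n (Ψ j n x) = Ψ j (n + 1) fun i => degMul 𝒜 (g u) n (x i)) ∧
    ∀ n, G n = Submodule.span k (⋃ j, Set.range (Ψ j n))

variable {g : U →ₗ[k] 𝒜 1}

/-- A single family suffices: the a-fold product of elements of the image of R_n, which ring
homomorphisms preserve. -/
theorem multilinearlyGenerated_of_algHom (a : ℕ) {E : ℕ → Type u} [∀ n, CommRing (E n)]
    [∀ n, Algebra k (E n)] (f : ∀ n, 𝒜 n →ₗ[k] E n) {G : ∀ n, Submodule k (E n)}
    (hG : ∀ n, G n = LinearMap.range (f n) ^ a) (β : U → ∀ n, E n →ₐ[k] E (n + 1))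
    (hβ : ∀ u n x, β u n (f n x) = f (n + 1) (degMul 𝒜 (g u) n x)) :
    MultilinearlyGenerated g a G fun u n => (β u n).toLinearMap := by
  refine ⟨Unit, inferInstance, fun _ n =>
    (MultilinearMap.mkPiAlgebra k (Fin a) (E n)).compLinearMap fun _ => f n, ?_, ?_⟩
  · intro u _ n x
    simp [map_prod, hβ]
  · intro n
    rw [hG, LinearMap.range_pow_eq_span, Set.iUnion_const]
    rfl

theorem MultilinearlyGenerated.iSup {d : ℕ} {E : ℕ → Type u} [∀ n, AddCommGroup (E n)]
    [∀ n, Module k (E n)] {I : Type} [Finite I] {G : I → ∀ n, Submodule k (E n)}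
    {β : U → ∀ n, E n →ₗ[k] E (n + 1)} (h : ∀ i, MultilinearlyGenerated g d (G i) β) :
    MultilinearlyGenerated g d (fun n => ⨆ i, G i n) β := by
  choose J hJ Ψ hΨ hG using h
  refine ⟨Σ i, J i, inferInstance, fun p => Ψ p.1 p.2, fun u p n x => hΨ p.1 u p.2 n x,
    fun n => ?_⟩
  simp only [hG, Set.iUnion_sigma, Submodule.span_iUnion]

/-- Two families are combined by splitting the `a + a'` arguments into two blocks, one for each
tensor factor. -/
theorem MultilinearlyGenerated.tensor {a a' d : ℕ} (hd : a + a' = d)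
    {E E' : ℕ → Type u} [∀ n, AddCommGroup (E n)] [∀ n, Module k (E n)]
    [∀ n, AddCommGroup (E' n)] [∀ n, Module k (E' n)]
    {G : ∀ n, Submodule k (E n)} {G' : ∀ n, Submodule k (E' n)}
    {β : U → ∀ n, E n →ₗ[k] E (n + 1)} {β' : U → ∀ n, E' n →ₗ[k] E' (n + 1)}
    (h : MultilinearlyGenerated g a G β) (h' : MultilinearlyGenerated g a' G' β') :
    MultilinearlyGenerated g d
      (fun n => Submodule.map₂ (TensorProduct.mk k (E n) (E' n)) (G n) (G' n))
      fun u n => TensorProduct.map (β u n) (β' u n) := by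
  subst hd
  obtain ⟨J, hJ, Ψ, hΨ, hG⟩ := h
  obtain ⟨J', hJ', Ψ', hΨ', hG'⟩ := h'
  let Φ : J × J' → ∀ n, MultilinearMap k (fun _ : Fin (a + a') => 𝒜 n) (E n ⊗[k] E' n) :=
    fun p n => ((Ψ p.1 n).domCoprod (Ψ' p.2 n)).domDomCongr finSumFinEquiv
  have hΦ : ∀ p n x, Φ p n x = Ψ p.1 n (fun i => x (finSumFinEquiv (Sum.inl i)))
      ⊗ₜ[k] Ψ' p.2 n (fun i => x (finSumFinEquiv (Sum.inr i))) := fun _ _ _ => rfl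
  refine ⟨J × J', inferInstance, Φ, fun u p n x => ?_, fun n => ?_⟩
  · rw [hΦ, hΦ, TensorProduct.map_tmul, hΨ, hΨ']
  · beta_reduce
    rw [hG, hG', Submodule.map₂_span_span]
    congr 1
    ext z
    simp only [Set.mem_image2, Set.mem_iUnion, Set.mem_range]
    constructor
    · rintro ⟨_, ⟨j, x, rfl⟩, _, ⟨j', x', rfl⟩, rfl⟩
      refine ⟨(j, j'), fun i => Sum.elim x x' (finSumFinEquiv.symm i), ?_⟩
      rw [hΦ]
      simp
    · rintro ⟨p, x, rfl⟩
      exact ⟨_, ⟨p.1, _, rfl⟩, _, ⟨p.2, _, rfl⟩, (hΦ p n x).symm⟩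

/-- The map induced by multiplication by `u` on a stage of the bar resolution of `R[n]`. -/
abbrev veroneseBarMap (x : 𝒜 1) (n p : ℕ) :
    (bar (symDeg k (𝒜 n)) (veroneseDeg 𝒜 n) p).carrier →ₗ[k]
      (bar (symDeg k (𝒜 (n + 1))) (veroneseDeg 𝒜 (n + 1)) p).carrier :=
  barMap (symDeg k (𝒜 n)) (veroneseDeg 𝒜 n) (symDeg k (𝒜 (n + 1))) (veroneseDeg 𝒜 (n + 1))
    (symMap (degMul 𝒜 x n)) (veroneseMul 𝒜 x n).toLinearMap p

theorem multilinearlyGenerated_sym (a : ℕ) :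
    MultilinearlyGenerated g a (E := fun n => SymmetricAlgebra k (𝒜 n))
      (fun n => symDeg k (𝒜 n) a) fun u n => (symMap (degMul 𝒜 (g u) n)).toLinearMap :=
  multilinearlyGenerated_of_algHom a (fun n => SymmetricAlgebra.ι k (𝒜 n)) (fun _ => rfl) _
    fun u n x => by simp [symMap]

theorem multilinearlyGenerated_veronese (hpow : ∀ n a, 𝒜 (a * n) = 𝒜 n ^ a) (a : ℕ) :
    MultilinearlyGenerated g a (E := fun n => Veronese 𝒜 n)
      (fun n => veroneseDeg 𝒜 n a) fun u n => (veroneseMul 𝒜 (g u) n).toLinearMap := by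
  refine multilinearlyGenerated_of_algHom a (fun n => veroneseOne 𝒜 n)
    (fun n => veroneseDeg_eq_range_pow 𝒜 a (hpow n a)) _ fun u n x => ?_
  have h := AlgHom.congr_fun (veroneseMul_symToVeronese 𝒜 (g u) n) (SymmetricAlgebra.ι k _ x)
  simpa [symToVeronese, symMap] using h

/-- The pieces of degree `d` in the bar resolutions of the Veronese rings are generated by
multilinear maps. -/
theorem multilinearlyGenerated_bar (hpow : ∀ n a, 𝒜 (a * n) = 𝒜 n ^ a) (p d : ℕ) :
    MultilinearlyGenerated g d
      (E := fun n => (bar (symDeg k (𝒜 n)) (veroneseDeg 𝒜 n) p).carrier)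
      (fun n => (bar (symDeg k (𝒜 n)) (veroneseDeg 𝒜 n) p).deg d)
      fun u n => veroneseBarMap (g u) n p := by
  induction p generalizing d with
  | zero => exact multilinearlyGenerated_veronese hpow d
  | succ p ih =>
    -- There are finitely many splittings of `d`, independently of `n`; this keeps the index set `J`
    -- finite and uniform.
    have : Finite {q : ℕ × ℕ // q.1 + q.2 = d} :=
      Finite.of_equiv (Finset.HasAntidiagonal.antidiagonal d)
        (Equiv.subtypeEquivRight fun q => by simp)
    have h := MultilinearlyGenerated.iSup fun q : {q : ℕ × ℕ // q.1 + q.2 = d} =>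
      (multilinearlyGenerated_sym q.1.1).tensor q.2 (ih q.1.2)
    have e : ∀ n, (bar (symDeg k (𝒜 n)) (veroneseDeg 𝒜 n) p).tensorDeg (symDeg k (𝒜 n)) d
        = ⨆ q : {q : ℕ × ℕ // q.1 + q.2 = d}, Submodule.map₂ (TensorProduct.mk k _ _)
          (symDeg k (𝒜 n) q.1.1) ((bar (symDeg k (𝒜 n)) (veroneseDeg 𝒜 n) p).deg q.1.2) := by
      intro n
      rw [iSup_subtype, iSup_prod]
      rfl
    have e' := funext e
    have h' := h
    rw [← e'] at h'
    exact h'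

end MultilinearGeneration

/-! ### Presentation of the Tor groups by polynomials -/

section Presentation

open MvPolynomial

variable {k R : Type u} {U : Type v} [Field k] [AddCommGroup U] [Module k U]
  [CommRing R] [Algebra k R] {𝒜 : ℕ → Submodule k R} [GradedAlgebra 𝒜]
  (g : U →ₗ[k] 𝒜 1) {κ : Type} (b : Module.Basis κ k U)

/-- The monomial with exponents `β` in the images of the basis vectors. -/
def gradedMonomial [Fintype κ] {n : ℕ} (β : κ → ℕ) (hβ : ∑ i, β i = n) : 𝒜 n :=
  ⟨∏ i, (g (b i) : R) ^ β i, by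
    have h := SetLike.prod_mem_graded 𝒜 (F := Finset.univ) (fun i => β i • 1)
      (fun i => (g (b i) : R) ^ β i) fun i _ => SetLike.pow_mem_graded (β i) (g (b i)).2
    simpa [hβ] using h⟩

theorem degMul_gradedMonomial [Fintype κ] {n : ℕ} (β : κ → ℕ) (hβ : ∑ i, β i = n)
    (hβ' : ∀ i : κ, ∑ i', (β i' + Finsupp.single i 1 i') = n + 1) (u : U) :
    degMul 𝒜 (g u) n (gradedMonomial g b β hβ)
      = ∑ i, b.repr u i • gradedMonomial g b _ (hβ' i) := by
  classical
  refine Subtype.ext ?_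
  rw [Submodule.coe_sum]
  change (g u : R) * ∏ i, (g (b i) : R) ^ β i = _
  conv_lhs => rw [← b.sum_repr u, map_sum, Submodule.coe_sum, Finset.sum_mul]
  refine Finset.sum_congr rfl fun i _ => ?_
  rw [map_smul, Submodule.coe_smul, Submodule.coe_smul, smul_mul_assoc]
  congr 1
  change _ = ∏ i', (g (b i') : R) ^ (β i' + Finsupp.single i 1 i')
  simp only [pow_add, Finset.prod_mul_distrib]
  rw [mul_comm]
  congr 1
  rw [Finset.prod_eq_single i (fun i' _ h => by rw [Finsupp.single_eq_of_ne h, pow_zero])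
    (by simp), Finsupp.single_eq_same, pow_one]

theorem span_range_gradedMonomial [Fintype κ]
    (hgen : ∀ m, 𝒜 m = LinearMap.range ((𝒜 1).subtype ∘ₗ g) ^ m) (n : ℕ) :
    Submodule.span k (Set.range fun β : {β : κ → ℕ // ∑ i, β i = n} =>
      gradedMonomial g b β.1 β.2) = ⊤ := by
  classical
  set N := Submodule.span k (Set.range fun β : {β : κ → ℕ // ∑ i, β i = n} =>
      gradedMonomial g b β.1 β.2)
  have hL : LinearMap.range ((𝒜 1).subtype ∘ₗ g)
      = Submodule.span k (Set.range fun i => (g (b i) : R)) := by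
    rw [LinearMap.range_eq_map, ← b.span_eq, Submodule.map_span, ← Set.range_comp]
    rfl
  suffices h : 𝒜 n ≤ N.map (𝒜 n).subtype by
    rw [eq_top_iff]
    rintro x -
    obtain ⟨y, hy, hyx⟩ := h x.2
    rwa [← Subtype.ext hyx]
  conv_lhs => rw [hgen n, hL, Submodule.span_pow]
  rw [Submodule.span_le]
  intro x hx
  obtain ⟨f, rfl⟩ := Set.mem_pow.1 hx
  choose φ hφ using fun t => (f t).2
  -- A product of images of basis vectors is a monomial whose exponents count how often each vector
  -- occurs.
  let β : κ → ℕ := fun i => (Finset.univ.filter fun t => φ t = i).card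
  have hβ : ∑ i, β i = n := by
    have h := Finset.card_eq_sum_card_fiberwise (f := φ) (s := Finset.univ) (t := Finset.univ)
      fun _ _ => Finset.mem_coe.2 (Finset.mem_univ _)
    rwa [Finset.card_univ, Fintype.card_fin, eq_comm] at h
  refine ⟨gradedMonomial g b β hβ, Submodule.subset_span ⟨⟨β, hβ⟩, rfl⟩, ?_⟩
  rw [List.prod_ofFn]
  change ∏ i, (g (b i) : R) ^ β i = _
  rw [← Finset.prod_fiberwise Finset.univ φ]
  refine Finset.prod_congr rfl fun i _ => ?_
  rw [← Finset.prod_const]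
  refine Finset.prod_congr rfl fun t ht => ?_
  rw [← hφ, (Finset.mem_filter.1 ht).2]

instance [Fintype κ] (n : ℕ) : Finite {β : κ → ℕ // ∑ i, β i = n} := by
  classical
  exact Finite.of_equiv (Finset.piAntidiag Finset.univ n)
    (Equiv.subtypeEquivRight fun β => by simp [Finset.mem_piAntidiag])

theorem MultiExponent.sum_eq [Fintype κ] {d n : ℕ} (α : MultiExponent κ d n) (j : Fin d) :
    ∑ i, α.1 (j, i) = n := by
  rw [← weight_formWeight, α.2]

/-- The linear map on polynomials that takes the monomials of degree `n` in the coefficients of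
each of `d` linear forms to the values of a multilinear map on `R_n`. -/
def multilinearToPoly [Fintype κ] {d n : ℕ} {E : Type*} [AddCommGroup E] [Module k E]
    (Ψ : MultilinearMap k (fun _ : Fin d => 𝒜 n) E) : MvPolynomial (Fin d × κ) k →ₗ[k] E := by
  classical
  exact (basisMonomials (Fin d × κ) k).constr k fun α =>
    -- The value 0 on other monomials is a mere default: only polynomials in `multiDeg k κ d n`
    -- matter.
    if h : Finsupp.weight (formWeight κ d) α = fun _ => n then
      Ψ fun j => gradedMonomial g b (fun i => α (j, i)) (MultiExponent.sum_eq ⟨α, h⟩ j)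
    else 0

theorem multilinearToPoly_monomial [Fintype κ] {d n : ℕ} {E : Type*} [AddCommGroup E] [Module k E]
    (Ψ : MultilinearMap k (fun _ : Fin d => 𝒜 n) E) (α : MultiExponent κ d n) :
    multilinearToPoly g b Ψ (monomial α.1 1)
      = Ψ fun j => gradedMonomial g b (fun i => α.1 (j, i)) (α.sum_eq j) := by
  rw [multilinearToPoly, ← congrFun (coe_basisMonomials (Fin d × κ) k) α.1,
    Module.Basis.constr_basis, dif_pos α.2]

theorem multiDeg_eq_span (d n : ℕ) :
    multiDeg k κ d n
      = Submodule.span k (Set.range fun α : MultiExponent κ d n => monomial α.1 (1 : k)) := by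
  refine le_antisymm (fun p hp => ?_) (Submodule.span_le.2 ?_)
  · rw [p.as_sum]
    refine Submodule.sum_mem _ fun α hα => ?_
    have h : monomial α (coeff α p) = coeff α p • monomial α (1 : k) := by
      rw [smul_monomial, smul_eq_mul, mul_one]
    rw [h]
    exact Submodule.smul_mem _ _ (Submodule.subset_span ⟨⟨α, hp (mem_support_iff.1 hα)⟩, rfl⟩)
  · rintro _ ⟨α, rfl⟩
    exact isWeightedHomogeneous_monomial _ _ _ α.2

theorem prodPullLinear_dpow_mul_monomial [Fintype κ] {d : ℕ} (u : U) (α : Fin d × κ →₀ ℕ) :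
    prodPullLinear b d (dpow k d u) * monomial α 1
      = ∑ φ : Fin d → κ, (∏ j, b.repr u (φ j)) •
        monomial (α + ∑ j, Finsupp.single (j, φ j) 1) (1 : k) := by
  classical
  rw [prodPullLinear_dpow]
  simp only [genericForm_apply]
  rw [Finset.prod_univ_sum, Fintype.piFinset_univ, Finset.sum_mul]
  refine Finset.sum_congr rfl fun φ _ => ?_
  rw [Finset.prod_smul, smul_mul_assoc]
  congr 1
  rw [add_comm, ← one_mul (1 : k), ← monomial_mul, monomial_sum_one, one_mul]
  rfl

theorem add_sum_single_apply {d : ℕ} (α : Fin d × κ →₀ ℕ) (φ : Fin d → κ) (j : Fin d) (i : κ) :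
    (α + ∑ j, Finsupp.single (j, φ j) 1 : Fin d × κ →₀ ℕ) (j, i)
      = α (j, i) + Finsupp.single (φ j) 1 i := by
  classical
  rw [Finsupp.add_apply, Finsupp.finsetSum_apply, Finset.sum_eq_single j]
  · simp [Finsupp.single_apply]
  · intro j' _ h
    rw [Finsupp.single_apply, if_neg fun e => h (congrArg Prod.fst e)]
  · simp

/-- On a monomial, both sides expand as the same sum over the choices `φ` of one basis vector in
each of the `d` factors: on the left by expanding the product of the generic forms, on the right by
multilinearity of `Ψ'`. -/
theorem multilinearToPoly_mul [Fintype κ] {d n : ℕ} {E E' : Type*} [AddCommGroup E] [Module k E]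
    [AddCommGroup E'] [Module k E'] (Ψ : MultilinearMap k (fun _ : Fin d => 𝒜 n) E)
    (Ψ' : MultilinearMap k (fun _ : Fin d => 𝒜 (n + 1)) E') (β : E →ₗ[k] E') (u : U)
    (h : ∀ x, β (Ψ x) = Ψ' fun i => degMul 𝒜 (g u) n (x i)) (p : MvPolynomial (Fin d × κ) k)
    (hp : p ∈ multiDeg k κ d n) :
    multilinearToPoly g b Ψ' (prodPullLinear b d (dpow k d u) * p)
      = β (multilinearToPoly g b Ψ p) := by
  rw [multiDeg_eq_span] at hp
  have key : Set.EqOn (multilinearToPoly g b Ψ' ∘ₗ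
      LinearMap.mulLeft k (prodPullLinear b d (dpow k d u))) (β ∘ₗ multilinearToPoly g b Ψ)
      (Set.range fun α : MultiExponent κ d n => monomial α.1 (1 : k)) := by
    rintro _ ⟨α, rfl⟩
    have hsum : ∀ (j : Fin d) (i : κ),
        ∑ i', (α.1 (j, i') + Finsupp.single i 1 i') = n + 1 := by
      classical
      intro j i
      rw [Finset.sum_add_distrib, α.sum_eq, Finset.sum_eq_single i
        (fun i' _ h => Finsupp.single_eq_of_ne h) (by simp), Finsupp.single_eq_same]
    have e1 : (fun j => degMul 𝒜 (g u) n
        (gradedMonomial g b (fun i => α.1 (j, i)) (α.sum_eq j)))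
        = fun j => ∑ i, b.repr u i • gradedMonomial g b _ (hsum j i) :=
      funext fun j => degMul_gradedMonomial g b _ (α.sum_eq j) (hsum j) u
    rw [LinearMap.comp_apply, LinearMap.comp_apply, LinearMap.mulLeft_apply,
      multilinearToPoly_monomial, h, e1, prodPullLinear_dpow_mul_monomial, map_sum]
    rw [MultilinearMap.map_sum]
    refine Finset.sum_congr rfl fun φ _ => ?_
    rw [MultilinearMap.map_smul_univ, map_smul]
    congr 1
    have hw : Finsupp.weight (formWeight κ d) (α.1 + ∑ j, Finsupp.single (j, φ j) 1)
        = fun _ => n + 1 := by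
      funext j
      rw [weight_formWeight, ← hsum j (φ j)]
      exact Finset.sum_congr rfl fun i _ => add_sum_single_apply α.1 φ j i
    refine (multilinearToPoly_monomial g b Ψ' ⟨_, hw⟩).trans ?_
    congr 1
    funext j
    refine Subtype.ext (Finset.prod_congr rfl fun i _ => ?_)
    exact congrArg _ (add_sum_single_apply α.1 φ j i)
  exact LinearMap.eqOn_span key hp

theorem mem_map_multilinearToPoly [Fintype κ]
    (hgen : ∀ m, 𝒜 m = LinearMap.range ((𝒜 1).subtype ∘ₗ g) ^ m) {d n : ℕ} {E : Type*}
    [AddCommGroup E] [Module k E] (Ψ : MultilinearMap k (fun _ : Fin d => 𝒜 n) E)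
    (x : Fin d → 𝒜 n) : Ψ x ∈ (multiDeg k κ d n).map (multilinearToPoly g b Ψ) := by
  classical
  have := Fintype.ofFinite {β : κ → ℕ // ∑ i, β i = n}
  have hx : ∀ j, ∃ c : {β : κ → ℕ // ∑ i, β i = n} → k,
      ∑ β, c β • gradedMonomial g b β.1 β.2 = x j := fun j =>
    (Submodule.mem_span_range_iff_exists_fun k).1
      ((span_range_gradedMonomial g b hgen n).symm ▸ Submodule.mem_top)
  choose c hc using hx
  rw [← funext hc, MultilinearMap.map_sum]
  refine Submodule.sum_mem _ fun φ _ => ?_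
  rw [MultilinearMap.map_smul_univ]
  refine Submodule.smul_mem _ _ ?_
  let α : Fin d × κ →₀ ℕ := Finsupp.equivFunOnFinite.symm fun q => (φ q.1).1 q.2
  have hα : Finsupp.weight (formWeight κ d) α = fun _ => n := by
    funext j
    rw [weight_formWeight]
    exact (φ j).2
  exact ⟨monomial α 1, isWeightedHomogeneous_monomial _ _ _ hα,
    multilinearToPoly_monomial g b Ψ ⟨α, hα⟩⟩

variable {g}

/-- A multilinearly generated system is a quotient of copies of `multiDeg k κ d n`. -/
theorem MultilinearlyGenerated.exists_presentation [Fintype κ]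
    (hgen : ∀ m, 𝒜 m = LinearMap.range ((𝒜 1).subtype ∘ₗ g) ^ m) {d : ℕ} {E : ℕ → Type u}
    [∀ n, AddCommGroup (E n)] [∀ n, Module k (E n)] {G : ∀ n, Submodule k (E n)}
    {β : U → ∀ n, E n →ₗ[k] E (n + 1)} (h : MultilinearlyGenerated g d G β) :
    ∃ (J : Type) (_ : Finite J) (F : ∀ n, (J → MvPolynomial (Fin d × κ) k) →ₗ[k] E n),
      (∀ u n m, (∀ j, m j ∈ multiDeg k κ d n) →
        F (n + 1) (prodPullLinear b d (dpow k d u) • m) = β u n (F n m)) ∧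
      ∀ n, ∀ x ∈ G n, ∃ m, (∀ j, m j ∈ multiDeg k κ d n) ∧ F n m = x := by
  classical
  obtain ⟨J, hJ, Ψ, hΨ, hG⟩ := h
  have := Fintype.ofFinite J
  refine ⟨J, hJ, fun n => ∑ j, multilinearToPoly g b (Ψ j n) ∘ₗ LinearMap.proj j, ?_, ?_⟩
  · intro u n m hm
    simp only [LinearMap.sum_apply, LinearMap.comp_apply, LinearMap.proj_apply, map_sum,
      Pi.smul_apply, smul_eq_mul]
    exact Finset.sum_congr rfl fun j _ =>
      multilinearToPoly_mul g b _ _ _ u (hΨ u j n) (m j) (hm j)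
  · intro n x hx
    let N : Submodule k (J → MvPolynomial (Fin d × κ) k) :=
      Submodule.pi Set.univ fun _ => multiDeg k κ d n
    suffices H : G n ≤ N.map (∑ j, multilinearToPoly g b (Ψ j n) ∘ₗ LinearMap.proj j) by
      obtain ⟨m, hm, e⟩ := H hx
      exact ⟨m, fun j => hm j trivial, e⟩
    rw [hG, Submodule.span_le]
    intro y hy
    obtain ⟨j, x, rfl⟩ := Set.mem_iUnion.1 hy
    obtain ⟨p, hp, e⟩ := mem_map_multilinearToPoly g b hgen (Ψ j n) x
    refine ⟨Pi.single j p, fun j' _ => ?_, ?_⟩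
    · by_cases hj : j' = j
      · subst hj
        rwa [Pi.single_eq_same]
      · rw [Pi.single_eq_of_ne hj]
        exact zero_mem _
    · rw [LinearMap.sum_apply, Finset.sum_eq_single j]
      · simpa using e
      · intro j' _ hj
        simp [Pi.single_eq_of_ne hj]
      · simp

theorem torCycles_le_deg {k : Type u} {S M : Type v} [Field k] [CommRing S] [Algebra k S]
    [AddCommGroup M] [Module k M] [Module S M] [IsScalarTower k S M] (ε : S →ₐ[k] k)
    (𝒮 : ℕ → Submodule k S) (ℳ : ℕ → Submodule k M) (p d : ℕ) :
    torCycles ε 𝒮 ℳ p d ≤ (bar 𝒮 ℳ p).deg d := by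
  cases p with
  | zero => exact le_rfl
  | succ p => exact inf_le_left

/-- The Tor groups of the Veronese rings as subquotients of the spaces `multiDeg k κ d n`. -/
theorem exists_isMultiplicationSystem [Fintype κ]
    (hgen : ∀ m, 𝒜 m = LinearMap.range ((𝒜 1).subtype ∘ₗ g) ^ m) (i d : ℕ) :
    ∃ (J : Type) (_ : Finite J)
      (Q : ∀ n, Submodule k ((J → MvPolynomial (Fin d × κ) k) × VeroneseTor 𝒜 i d n)),
      IsMultiplicationSystem b (fun u n => veroneseTorMap 𝒜 (g u) i d n) Q := by
  obtain ⟨J, hJ, F, hF, hsurj⟩ :=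
    (multilinearlyGenerated_bar (g := g) (Submodule.eq_pow_of_eq_pow hgen) i d).exists_presentation
      b hgen
  let C : ∀ n, Submodule k (bar (symDeg k (𝒜 n)) (veroneseDeg 𝒜 n) i).carrier := fun n =>
    torCycles SymmetricAlgebra.algebraMapInv (symDeg k (𝒜 n)) (veroneseDeg 𝒜 n) i d
  let q : ∀ n, C n →ₗ[k] VeroneseTor 𝒜 i d n := fun n => Submodule.mkQ _
  -- The pairs of a cycle and a multihomogeneous preimage of it; passing from cycles to their
  -- classes gives the relation `Q n`.
  let W : ∀ n, Submodule k ((J → MvPolynomial (Fin d × κ) k) × C n) := fun n =>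
    LinearMap.eqLocus (F n ∘ₗ LinearMap.fst k _ _) ((C n).subtype ∘ₗ LinearMap.snd k _ _) ⊓
      (Submodule.pi Set.univ fun _ => multiDeg k κ d n).comap (LinearMap.fst k _ _)
  have hW : ∀ n m c, (m, c) ∈ W n ↔ F n m = c ∧ ∀ j, m j ∈ multiDeg k κ d n := by
    intro n m c
    refine ⟨fun h => ⟨h.1, fun j => h.2 j trivial⟩, fun h => ⟨h.1, fun j _ => h.2 j⟩⟩
  refine ⟨J, hJ, fun n => (W n).map (LinearMap.prodMap LinearMap.id (q n)), ?_, ?_, ?_, ?_⟩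
  · rintro n _ _ ⟨⟨m, c⟩, h, e⟩ j
    cases e
    exact ((hW n m c).1 h).2 j
  · rintro n v ⟨⟨m, c⟩, h, e⟩
    cases e
    have h0 : F n 0 = c := ((hW n _ c).1 h).1
    have : c = 0 := Subtype.ext (h0.symm.trans (map_zero _))
    rw [this]
    exact map_zero _
  · intro n v
    obtain ⟨c, rfl⟩ := Submodule.mkQ_surjective _ v
    obtain ⟨m, hm, e⟩ := hsurj n c (torCycles_le_deg _ _ _ i d c.2)
    exact ⟨m, (m, c), (hW n m c).2 ⟨e, hm⟩, rfl⟩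
  · rintro u n _ _ ⟨⟨m, c⟩, h, e⟩
    cases e
    obtain ⟨h1, h2⟩ := (hW n m c).1 h
    -- The map on Tor is by construction induced by the map on cycles, so the image cycle represents
    -- the image class.
    obtain ⟨c', hc', e'⟩ : ∃ c' : C (n + 1),
        (c' : (bar (symDeg k (𝒜 (n + 1))) (veroneseDeg 𝒜 (n + 1)) i).carrier)
          = veroneseBarMap (g u) n i c ∧ q (n + 1) c' = veroneseTorMap 𝒜 (g u) i d n (q n c) :=
      ⟨_, rfl, rfl⟩
    refine ⟨(prodPullLinear b d (dpow k d u) • m, c'), (hW _ _ _).2 ⟨?_, fun j => ?_⟩,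
      Prod.ext rfl e'⟩
    · rw [hF u n m h2, h1, hc']
    · have h3 := IsWeightedHomogeneous.mul (prodPullLinear_mem b d (dpow k d u)) (h2 j)
      rw [add_comm] at h3
      exact h3

end Presentation

end

theorem mainTheorem1 {k R : Type u} {U : Type v} [Field k] [IsAlgClosed k]
    [AddCommGroup U] [Module k U] [FiniteDimensional k U]
    [CommRing R] [Algebra k R] (𝒜 : ℕ → Submodule k R) [GradedAlgebra 𝒜]
    (π : SymmetricAlgebra k U →ₐ[k] R) (hπ : Function.Surjective π)
    (g : U →ₗ[k] 𝒜 1) (hg : ∀ u, π (SymmetricAlgebra.ι k U u) = g u) (i d : ℕ) :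
    (∃! ρ : SymmetricAlgebra k (dividedPower k U d) →ₐ[k] Module.End k (VeroneseTorSum 𝒜 i d),
      IsMultiplicationAction 𝒜 g i d ρ) ∧
    (∀ ρ : SymmetricAlgebra k (dividedPower k U d) →ₐ[k] Module.End k (VeroneseTorSum 𝒜 i d),
      IsMultiplicationAction 𝒜 g i d ρ →
      letI : Module (SymmetricAlgebra k (dividedPower k U d)) (VeroneseTorSum 𝒜 i d) :=
        Module.compHom _ ρ.toRingHom
      Module.Finite (SymmetricAlgebra k (dividedPower k U d)) (VeroneseTorSum 𝒜 i d) ∧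
      Module.support (SymmetricAlgebra k (dividedPower k U d)) (VeroneseTorSum 𝒜 i d) ⊆
        PrimeSpectrum.zeroLocus (chowIdeal k U d : Set (SymmetricAlgebra k (dividedPower k U d)))) ∧
    (∀ n, FiniteDimensional k (VeroneseTor 𝒜 i d n)) ∧
    ∃ P : Polynomial ℚ,
      (P = 0 ∨ (P.natDegree : ℤ) ≤ ((Module.finrank k U : ℤ) - 1) * d) ∧
      ∀ᶠ n : ℕ in Filter.atTop,
        (Module.finrank k (VeroneseTor 𝒜 i d n) : ℚ) = P.eval (n : ℚ) := by
  have : Infinite k := IsAlgClosed.instInfinite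
  let b := Module.finBasis k U
  obtain ⟨J, _, Q, h⟩ := exists_isMultiplicationSystem b (eq_range_pow hπ hg) i d
  refine ⟨?_, fun ρ hρ => h.finite_and_support ρ hρ, h.finiteDimensional, ?_⟩
  · obtain ⟨ρ, hρ⟩ := h.exists_algHom
    exact ⟨ρ, hρ, fun ρ' hρ' => IsMultiplicationSystem.algHom_eq b hρ' hρ⟩
  · obtain ⟨P, hP, hP'⟩ := h.exists_polynomial
    rw [Fintype.card_fin] at hP
    exact ⟨P, hP, hP'⟩
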